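/- Let $A$ be a Boolean algebra. Ideals of $A$ may be improper; an ideal $I$ is dense if every nonzero $a\in A$ has a nonzero $b\le a$ with $b\in I$. Homomorphisms between ideals preserve $\cap$, $\cup$ and $0$. Let $\mathrm{Aut}_3(A)$ be the set of all $f$ such that, for some dense ideal $I$ of $A$, $f$ is an endomorphism of $I$ onto $I$ with $f(x)=0\Leftrightarrow x=0$ for $x\in I$; $\mathrm{Aut}_4(A)$ is defined in the same way with an arbitrary ideal $I$. Let $\mathrm{Aut}_5(A)$ (respectively $\mathrm{Aut}_6(A)$) be the set of all $f$ such that, for some dense ideals (respectively arbitrary ideals) $I,J$ of $A$, $f$ is a homomorphism from $I$ onto $J$ with $f(x)=0\Leftrightarrow x=0$ for $x\in I$. Let $\mathrm{Autv}_e(A)$ be the set of those $f\in\mathrm{Aut}_e(A)$ that are everywhere onto: whenever $x\in\mathrm{Dom}\,f$, $y\in\mathrm{Rang}\,f$ and $y\le f(x)$, there is $z\le x$ in $\mathrm{Dom}\,f$ with $f(z)=y$. For partial functions $f,g$ from $A$ to $A$ such that $f(x)=0\Leftrightarrow x=0$ on $\mathrm{Dom}\,f$, likewise for $g$, and both are defined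 at $0$, write $f\sim g$ if the set of all $x\in A$ such that $f(x),g(x)$ are both defined and equal, or are both undefined, includes a dense ideal of $A$. Put $aut^\sim_e(A)=|\{f/{\sim}: f\in \mathrm{Aut}_e(A)\}|$ and $autv^\sim_e(A)=|\{f/{\sim}: f\in \mathrm{Autv}_e(A)\}|$. Finally, let $idc(A)$ be the number of ideals $I$ of $A$ with $I=I^c$, where $I^c$ is the set of all $x\in A$ such that every nonzero $y\le x$ has a nonzero $z\le y$ with $z\in I$. Main Lemma. For every infinite Boolean algebra $A$: (1) Either $aut^\sim_3(A)=aut^\sim_5(A)$, and moreover for $e=3,5$ this is also the number of classes $f/{\sim}$ of those $f\in\mathrm{Aut}_e(A)$ that have order two (that is, $f$ maps its domain to itself, $f\circ f$ is the identity on the domain, and $f$ is not); or $aut^\sim_3(A)$ and $aut^\sim_5(A)$ are both finite. (2) If $aut^\sim_e(A)>idc(A)$ for some $e\in\{3,4,5,6\}$, then $aut^\sim_3(A)=aut^\sim_4(A)=aut^\sim_5(A)=aut^\sim_6(A)$. (3) $aut^\sim_3(A)=aut^\sim_3(A)^{\aleph_0}$ or $aut^\sim_3(A)$ is finite. (4)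 $autv^\sim_e(A)=autv^\sim_3(A)+idc(A)$ for $e=4,6$. -/

import Mathlib

open Cardinal

universe u

namespace BAIdeal

variable {A : Type u} [BooleanAlgebra A]

/-- An ideal `I` (possibly all of `A`) is dense if every nonzero element of `A` has a nonzero
element of `I` below it. -/
def IsDense (I : Order.Ideal A) : Prop :=
  ∀ a : A, a ≠ ⊥ → ∃ b ∈ I, b ≠ ⊥ ∧ b ≤ a

/-- `I` is dense below `x`. -/
def IsDenseBelow (I : Order.Ideal A) (x : A) : Prop :=
  ∀ y : A, y ≤ x → y ≠ ⊥ → ∃ z ∈ I, z ≠ ⊥ ∧ z ≤ y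

/-- `I ^ c`, the set of `x` such that `I` is dense below `x`. -/
def closureSet (I : Order.Ideal A) : Set A := {x | IsDenseBelow I x}

variable (A) in
/-- The set of ideals `I` of `A` with `I ^ c = I`. -/
def Idc : Set (Order.Ideal A) := {I | closureSet I = (I : Set A)}

variable (A) in
/-- The number of ideals `I` of `A` with `I ^ c = I`. -/
noncomputable def idc : Cardinal.{u} := #(Idc A)

/-- The partial function `f` is a homomorphism with domain the ideal `I` and range exactly the
ideal `J`; it preserves meets, joins and `⊥`. -/
structure IsHomOnto (f : A →. A) (I J : Order.Ideal A) : Prop where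
  dom_eq : f.Dom = (I : Set A)
  ran_eq : f.ran = (J : Set A)
  map_bot : ⊥ ∈ f ⊥
  map_sup : ∀ x y x' y' : A, x' ∈ f x → y' ∈ f y → x' ⊔ y' ∈ f (x ⊔ y)
  map_inf : ∀ x y x' y' : A, x' ∈ f x → y' ∈ f y → x' ⊓ y' ∈ f (x ⊓ y)

/-- The four kinds of partial maps that are counted, with subscripts 3, 4, 5, 6. -/
inductive Kind : Type
  | k3 : Kind
  | k4 : Kind
  | k5 : Kind
  | k6 : Kind

variable (A) in
/-- `End_e(A)`: onto endomorphisms of a dense ideal (3), onto endomorphisms of an ideal (4),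
homomorphisms of a dense ideal onto a dense ideal (5), of an ideal onto an ideal (6). -/
def EndSet : Kind → Set (A →. A)
  | Kind.k3 => {f | ∃ I : Order.Ideal A, IsDense I ∧ IsHomOnto f I I}
  | Kind.k4 => {f | ∃ I : Order.Ideal A, IsHomOnto f I I}
  | Kind.k5 => {f | ∃ I J : Order.Ideal A, IsDense I ∧ IsDense J ∧ IsHomOnto f I J}
  | Kind.k6 => {f | ∃ I J : Order.Ideal A, IsHomOnto f I J}

/-- `f x = 0` exactly when `x = 0`, for `x` in the domain of `f`. -/
def TrivialKernel (f : A →. A) : Prop :=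
  ∀ x ∈ f.Dom, ⊥ ∈ f x ↔ x = ⊥

/-- Whenever `y ≤ f x` is in the range of `f`, it is the value of `f` at some `w ≤ x`. -/
def EverywhereOnto (f : A →. A) : Prop :=
  ∀ x z y : A, z ∈ f x → y ∈ f.ran → y ≤ z → ∃ w : A, w ≤ x ∧ y ∈ f w

variable (A) in
/-- `Aut_e(A)`. -/
def AutSet (e : Kind) : Set (A →. A) := {f | f ∈ EndSet A e ∧ TrivialKernel f}

variable (A) in
/-- `Endv_e(A)`: as `EndSet`, with "onto" strengthened to "everywhere onto". -/
def EndvSet (e : Kind) : Set (A →. A) := {f | f ∈ EndSet A e ∧ EverywhereOnto f}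

variable (A) in
/-- `Autv_e(A)`. -/
def AutvSet (e : Kind) : Set (A →. A) := {f | f ∈ EndvSet A e ∧ TrivialKernel f}

/-- The set of points of the domain of `f` at which `f` takes the value `0`. -/
def ker (f : A →. A) : Set A := {x | ⊥ ∈ f x}

/-- `f ∼ g`: the kernels agree, and `{x | f x = g x, or both are undefined}` includes a dense ideal
modulo the common kernel. A dense ideal of the quotient by the kernel is given by its preimage, an
ideal `D` of `A` that includes the kernel. The equation `f x = g x` is one between elements of
`Part A`: it holds if both sides are undefined, or both are defined with the same value. -/
def Sim (f g : A →. A) : Prop :=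
  ker f = ker g ∧ ∃ D : Order.Ideal A, ker f ⊆ (D : Set A) ∧
    (∀ a : A, a ∉ ker f → ∃ b ∈ D, b ∉ ker f ∧ b ≤ a) ∧ ∀ x ∈ D, f x = g x

theorem Sim.refl (f : A →. A) : Sim f f :=
  ⟨rfl, ⊤, fun _ _ => trivial, fun a ha => ⟨a, trivial, ha, le_rfl⟩, fun _ _ => rfl⟩

theorem Sim.symm {f g : A →. A} (h : Sim f g) : Sim g f := by
  obtain ⟨hk, D, h1, h2, h3⟩ := h
  exact ⟨hk.symm, D, hk ▸ h1, hk ▸ h2, fun x hx => (h3 x hx).symm⟩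

theorem Sim.trans {f g h : A →. A} (hfg : Sim f g) (hgh : Sim g h) : Sim f h := by
  obtain ⟨hk, D, h1, h2, h3⟩ := hfg
  obtain ⟨hk', D', h1', h2', h3'⟩ := hgh
  rw [← hk] at h1' h2'
  refine ⟨hk.trans hk', D ⊓ D', fun x hx => ⟨h1 hx, h1' hx⟩, fun a ha => ?_, fun x hx => ?_⟩
  · obtain ⟨b, hb, hbk, hba⟩ := h2 a ha
    obtain ⟨c, hc, hck, hcb⟩ := h2' b hbk
    exact ⟨c, ⟨D.lower hcb hb, hc⟩, hck, hcb.trans hba⟩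
  · exact (h3 x hx.1).trans (h3' x hx.2)

variable (A) in
/-- The relation `∼` as an equivalence relation. -/
def simSetoid : Setoid (A →. A) := ⟨Sim, Sim.refl, Sim.symm, Sim.trans⟩

/-- The cardinality of `{f/∼ : f ∈ S}`. -/
noncomputable def classCount (S : Set (A →. A)) : Cardinal.{u} :=
  #((Quotient.mk (simSetoid A)) '' S : Set (Quotient (simSetoid A)))

variable (A) in
/-- `aut^∼_e(A)`. -/
noncomputable def autSim (e : Kind) : Cardinal.{u} := classCount (AutSet A e)

variable (A) in
/-- `autv^∼_e(A)`. -/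
noncomputable def autvSim (e : Kind) : Cardinal.{u} := classCount (AutvSet A e)

/-- `f` maps its domain to itself, `f ∘ f` is the identity of the domain, `f` is not. -/
def IsOrderTwo (f : A →. A) : Prop :=
  (∀ x y : A, y ∈ f x → x ∈ f y) ∧ ∃ x y : A, y ∈ f x ∧ y ≠ x

variable (A) in
/-- The number of classes modulo `∼` of elements of order two of `Aut_e(A)`. -/
noncomputable def autSimOrderTwo (e : Kind) : Cardinal.{u} :=
  classCount {f | f ∈ AutSet A e ∧ IsOrderTwo f}

end BAIdeal

open BAIdeal

/-! Everything is read off the completion of `A`, realised as the sets U with U = U^⊥⊥. Since I^c =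
I^⊥⊥ for an ideal I, it has exactly idc(A) elements. A homomorphism of ideals with trivial kernel is
an isomorphism of ideals, so it is automatically everywhere onto, and the Autv counts are the Aut
counts. It extends to an isomorphism between principal ideals of the completion, and maps with equal
extensions are equivalent under ∼. The extensions lie in the pseudogroup P of partial isomorphisms
that come from `A` on a dense part of their domain; for maps between dense ideals they lie in the
group G of those with domain and range ⊤. Conversely, an involution in G restricts to an element of
Aut_3, and different involutions give different classes.

It remains to compare P and G with the set of involutions. Every partial isomorphism is the identity
off three pieces which it moves off themselves (`exists_three_pieces`). One with disjoint domain and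
range is known from the involution that swaps the two, up to its domain, and a second involution
encodes the domain (`mk_disj_le_inv`). So #G is at most the sixth power of the number of
involutions: either all are finite, or #G, aut_3, aut_5 and the order-two counts coincide. For P one
also records domains, at the price of factors idc(A); the identities of the closed ideals show that
idc(A) is attained. Hence aut_4 = aut_6 = aut_3 + idc(A).

Finally #G is finite or equal to its ℵ₀-th power (`mk_grp_top_lt_aleph0_or_power_eq`). G is a
product over a partition of ⊤ into invariant elements. Below an invariant element with the least
possible group there are either infinitely many disjoint invariant pieces, or a minimal one, on
which P is ergodic; there the group is counted by comparing all pieces with a single small one. -/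

namespace BAIdeal

/-! ### Partial isomorphisms of a complete Boolean algebra -/

/-- A partial isomorphism of a Boolean algebra between two principal ideals, given by a pair of
monotone functions that are inverse to each other on these ideals. -/
structure PIso (B : Type u) [CompleteBooleanAlgebra B] where
  toFun : B → B
  invFun : B → B
  mono : Monotone toFun
  mono_inv : Monotone invFun
  left_inv : ∀ x, invFun (toFun x) = x ⊓ invFun ⊤
  right_inv : ∀ y, toFun (invFun y) = y ⊓ toFun ⊤

namespace PIso

variable {B : Type u} [CompleteBooleanAlgebra B]

/-- The largest element of the domain. -/
def dom (φ : PIso B) : B := φ.invFun ⊤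

/-- The largest element of the range. -/
def ran (φ : PIso B) : B := φ.toFun ⊤

instance : CoeFun (PIso B) fun _ => B → B := ⟨toFun⟩

/-- The inverse partial isomorphism. -/
def symm (φ : PIso B) : PIso B := ⟨φ.invFun, φ.toFun, φ.mono_inv, φ.mono, φ.right_inv, φ.left_inv⟩

@[simp] theorem dom_symm (φ : PIso B) : φ.symm.dom = φ.ran := rfl
@[simp] theorem ran_symm (φ : PIso B) : φ.symm.ran = φ.dom := rfl

@[simp] theorem symm_apply_apply (φ : PIso B) (x : B) : φ.symm (φ x) = x ⊓ φ.dom := φ.left_inv x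
@[simp] theorem apply_symm_apply (φ : PIso B) (x : B) : φ (φ.symm x) = x ⊓ φ.ran := φ.right_inv x

theorem apply_le_ran (φ : PIso B) (x : B) : φ x ≤ φ.ran := φ.mono le_top

theorem symm_apply_le_dom (φ : PIso B) (x : B) : φ.symm x ≤ φ.dom := φ.symm.apply_le_ran x

theorem apply_inf_dom (φ : PIso B) (x : B) : φ (x ⊓ φ.dom) = φ x := by
  rw [← symm_apply_apply, apply_symm_apply, inf_eq_left.2 (φ.apply_le_ran x)]

@[simp] theorem apply_dom (φ : PIso B) : φ φ.dom = φ.ran := by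
  rw [← top_inf_eq φ.dom, apply_inf_dom]; rfl

@[simp] theorem symm_apply_ran (φ : PIso B) : φ.symm φ.ran = φ.dom := φ.symm.apply_dom

protected theorem map_inf (φ : PIso B) (x y : B) : φ (x ⊓ y) = φ x ⊓ φ y := by
  refine le_antisymm (le_inf (φ.mono inf_le_left) (φ.mono inf_le_right)) ?_
  have h : φ (φ.symm (φ x ⊓ φ y)) = φ x ⊓ φ y := by
    rw [apply_symm_apply, inf_eq_left]; exact inf_le_left.trans (φ.apply_le_ran x)
  rw [← h]
  refine φ.mono (le_inf ?_ ?_)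
  · exact (φ.symm.mono inf_le_left).trans ((φ.symm_apply_apply x).le.trans inf_le_left)
  · exact (φ.symm.mono inf_le_right).trans ((φ.symm_apply_apply y).le.trans inf_le_left)

protected theorem map_iSup (φ : PIso B) {ι : Sort*} (f : ι → B) : φ (⨆ i, f i) = ⨆ i, φ (f i) := by
  refine le_antisymm ?_ (iSup_le fun i => φ.mono (le_iSup f i))
  have h : (⨆ i, f i) ⊓ φ.dom ≤ φ.symm (⨆ i, φ (f i)) := by
    rw [iSup_inf_eq]
    refine iSup_le fun i => ?_
    rw [← symm_apply_apply]
    exact φ.symm.mono (le_iSup (fun i => φ (f i)) i)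
  rw [← apply_inf_dom]
  exact (φ.mono h).trans ((φ.apply_symm_apply _).le.trans inf_le_left)

protected theorem map_sSup (φ : PIso B) (s : Set B) : φ (sSup s) = ⨆ x ∈ s, φ x := by
  rw [sSup_eq_iSup, PIso.map_iSup]
  exact iSup_congr fun i => PIso.map_iSup _ _

protected theorem map_sup (φ : PIso B) (x y : B) : φ (x ⊔ y) = φ x ⊔ φ y := by
  rw [sup_eq_iSup, PIso.map_iSup, sup_eq_iSup]
  exact iSup_congr fun b => by cases b <;> rfl

@[simp] protected theorem map_bot (φ : PIso B) : φ ⊥ = ⊥ := by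
  have h := φ.map_iSup (fun i : Empty => i.elim)
  rwa [iSup_of_empty, iSup_of_empty] at h

theorem apply_eq_bot (φ : PIso B) {x : B} : φ x = ⊥ ↔ x ⊓ φ.dom = ⊥ := by
  constructor
  · intro h; rw [← symm_apply_apply, h, PIso.map_bot]
  · intro h; rw [← apply_inf_dom, h, PIso.map_bot]

theorem apply_ne_bot (φ : PIso B) {x : B} (hx : x ≤ φ.dom) (h : x ≠ ⊥) : φ x ≠ ⊥ := by
  rwa [Ne, apply_eq_bot, inf_eq_left.2 hx]

theorem symm_apply_apply_of_le (φ : PIso B) {x : B} (hx : x ≤ φ.dom) : φ.symm (φ x) = x := by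
  rw [symm_apply_apply, inf_eq_left.2 hx]

theorem apply_symm_apply_of_le (φ : PIso B) {x : B} (hx : x ≤ φ.ran) : φ (φ.symm x) = x := by
  rw [apply_symm_apply, inf_eq_left.2 hx]

theorem disjoint_apply (φ : PIso B) {x y : B} (h : x ⊓ y = ⊥) : φ x ⊓ φ y = ⊥ := by
  rw [← PIso.map_inf, h, PIso.map_bot]

theorem ext {φ ψ : PIso B} (h : ∀ x, φ x = ψ x) : φ = ψ := by
  have hr : φ.ran = ψ.ran := h ⊤
  have key : ∀ {φ ψ : PIso B}, (∀ x, φ x = ψ x) → φ.dom ≤ ψ.dom := by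
    intro φ ψ h
    have hr : φ.ran = ψ.ran := h ⊤
    have : φ ψ.dom = φ.ran := by rw [h, apply_dom, hr]
    have := congrArg φ.symm this
    rw [symm_apply_apply, symm_apply_ran] at this
    rw [← this]; exact inf_le_left
  have hd : φ.dom = ψ.dom := le_antisymm (key h) (key fun x => (h x).symm)
  have hs : ∀ y, φ.symm y = ψ.symm y := by
    intro y
    have h1 : φ.symm y = φ.symm (ψ (ψ.symm y)) := by
      rw [apply_symm_apply, ← hr]; exact (φ.symm.apply_inf_dom y).symm
    rw [h1, ← h, symm_apply_apply, hd, inf_eq_left.2 (ψ.symm_apply_le_dom y)]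
  obtain ⟨f, f', _, _, _, _⟩ := φ
  obtain ⟨g, g', _, _, _, _⟩ := ψ
  obtain rfl : f = g := funext h
  obtain rfl : f' = g' := funext hs
  rfl

/-- The identity of the principal ideal below `b`. -/
def idOn (b : B) : PIso B where
  toFun x := x ⊓ b
  invFun x := x ⊓ b
  mono _ _ h := inf_le_inf_right b h
  mono_inv _ _ h := inf_le_inf_right b h
  left_inv x := by simp
  right_inv x := by simp

@[simp] theorem idOn_apply (b x : B) : idOn b x = x ⊓ b := rfl
@[simp] theorem idOn_dom (b : B) : (idOn b).dom = b := top_inf_eq b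
@[simp] theorem idOn_ran (b : B) : (idOn b).ran = b := top_inf_eq b
/-- First `φ`, then `ψ`. -/
def trans (φ ψ : PIso B) : PIso B where
  toFun x := ψ (φ x)
  invFun x := φ.symm (ψ.symm x)
  mono _ _ h := ψ.mono (φ.mono h)
  mono_inv _ _ h := φ.symm.mono (ψ.symm.mono h)
  left_inv x := by
    rw [symm_apply_apply, PIso.map_inf, symm_apply_apply, inf_assoc]
    congr 1
    exact inf_eq_right.2 (φ.symm_apply_le_dom _)
  right_inv x := by
    rw [apply_symm_apply, PIso.map_inf, apply_symm_apply, inf_assoc]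
    congr 1
    exact inf_eq_right.2 (ψ.apply_le_ran _)

@[simp] theorem trans_apply (φ ψ : PIso B) (x : B) : φ.trans ψ x = ψ (φ x) := rfl
theorem trans_dom (φ ψ : PIso B) : (φ.trans ψ).dom = φ.symm ψ.dom := rfl
theorem trans_ran (φ ψ : PIso B) : (φ.trans ψ).ran = ψ φ.ran := rfl
theorem trans_symm (φ ψ : PIso B) : (φ.trans ψ).symm = ψ.symm.trans φ.symm := rfl

/-- The restriction of `φ` to the elements below `b`. -/
def restr (φ : PIso B) (b : B) : PIso B := (idOn b).trans φ

@[simp] theorem restr_apply (φ : PIso B) (b x : B) : φ.restr b x = φ (x ⊓ b) := rfl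
@[simp] theorem restr_dom (φ : PIso B) (b : B) : (φ.restr b).dom = φ.dom ⊓ b := rfl
@[simp] theorem restr_ran (φ : PIso B) (b : B) : (φ.restr b).ran = φ b := by
  simp [restr, trans_ran]
theorem restr_symm_apply (φ : PIso B) (b x : B) : (φ.restr b).symm x = φ.symm x ⊓ b := rfl

theorem restr_restr (φ : PIso B) (b c : B) : (φ.restr b).restr c = φ.restr (b ⊓ c) :=
  ext fun x => by simp [inf_comm, inf_left_comm]

/-- The common extension of a family with disjoint domains and disjoint ranges. -/
def glue {ι : Type*} (φ : ι → PIso B) (hd : ∀ i j, i ≠ j → (φ i).dom ⊓ (φ j).dom = ⊥)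
    (hr : ∀ i j, i ≠ j → (φ i).ran ⊓ (φ j).ran = ⊥) : PIso B :=
  -- One computation serves both inverse laws: the second is the first for the inverse family.
  have key : ∀ (φ : ι → PIso B), (∀ i j, i ≠ j → (φ i).ran ⊓ (φ j).ran = ⊥) → ∀ x,
      ⨆ j, (φ j).symm (⨆ i, φ i x) = x ⊓ ⨆ i, (φ i).symm ⊤ := by
    intro φ hr x
    rw [inf_iSup_eq]
    refine iSup_congr fun j => ?_
    rw [PIso.map_iSup]
    refine le_antisymm (iSup_le fun i => ?_) ?_
    · by_cases h : i = j
      · subst h; exact (symm_apply_apply _ _).le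
      · have : (φ j).symm (φ i x) = ⊥ := by
          rw [apply_eq_bot, ← le_bot_iff, ← hr i j h]
          exact inf_le_inf_right _ (apply_le_ran _ _)
        rw [this]; exact bot_le
    · refine le_trans ?_ (le_iSup _ j)
      exact (symm_apply_apply _ _).ge
  { toFun := fun x => ⨆ i, φ i x
    invFun := fun x => ⨆ i, (φ i).symm x
    mono := fun _ _ h => iSup_mono fun i => (φ i).mono h
    mono_inv := fun _ _ h => iSup_mono fun i => (φ i).symm.mono h
    left_inv := key φ hr
    right_inv := key (fun i => (φ i).symm) hd }

section glue
variable {ι : Type*} (φ : ι → PIso B) (hd : ∀ i j, i ≠ j → (φ i).dom ⊓ (φ j).dom = ⊥)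
    (hr : ∀ i j, i ≠ j → (φ i).ran ⊓ (φ j).ran = ⊥)

theorem glue_apply (x : B) : glue φ hd hr x = ⨆ i, φ i x := rfl
theorem glue_dom : (glue φ hd hr).dom = ⨆ i, (φ i).dom := rfl
theorem glue_apply_of_le (i : ι) {x : B} (hx : ∀ j, j ≠ i → x ⊓ (φ j).dom = ⊥) :
    glue φ hd hr x = φ i x := by
  rw [glue_apply]
  refine le_antisymm (iSup_le fun j => ?_) (le_iSup (fun i => φ i x) i)
  by_cases h : j = i
  · rw [h]
  · rw [(apply_eq_bot _).2 (hx j h)]; exact bot_le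

theorem glue_restr_dom (i : ι) : (glue φ hd hr).restr (φ i).dom = φ i :=
  ext fun x => by
    rw [restr_apply, glue_apply_of_le φ hd hr i, apply_inf_dom]
    intro j hj
    rw [inf_assoc, hd i j (Ne.symm hj), inf_bot_eq]
end glue

/-- For `ψ` with disjoint domain and range below `e`, the involution of the principal ideal
below `e` that exchanges the domain with the range and fixes what is disjoint from both. -/
def swap (e : B) (ψ : PIso B) (h : ψ.dom ⊓ ψ.ran = ⊥) : PIso B :=
  glue (fun i : Fin 3 => ![ψ, ψ.symm, idOn (e \ (ψ.dom ⊔ ψ.ran))] i)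
    (by
      have h1 : ψ.dom ⊓ (e \ (ψ.dom ⊔ ψ.ran)) = ⊥ :=
        (disjoint_sdiff_self_right.mono_left le_sup_left).eq_bot
      have h2 : ψ.ran ⊓ (e \ (ψ.dom ⊔ ψ.ran)) = ⊥ :=
        (disjoint_sdiff_self_right.mono_left le_sup_right).eq_bot
      intro i j hij
      fin_cases i <;> fin_cases j <;> simp_all [inf_comm])
    (by
      have h1 : ψ.dom ⊓ (e \ (ψ.dom ⊔ ψ.ran)) = ⊥ :=
        (disjoint_sdiff_self_right.mono_left le_sup_left).eq_bot
      have h2 : ψ.ran ⊓ (e \ (ψ.dom ⊔ ψ.ran)) = ⊥ :=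
        (disjoint_sdiff_self_right.mono_left le_sup_right).eq_bot
      intro i j hij
      fin_cases i <;> fin_cases j <;> simp_all [inf_comm])

section swap
variable {e : B} {ψ : PIso B} (h : ψ.dom ⊓ ψ.ran = ⊥)

theorem swap_apply (x : B) :
    swap e ψ h x = ψ x ⊔ ψ.symm x ⊔ x ⊓ (e \ (ψ.dom ⊔ ψ.ran)) := by
  refine le_antisymm (iSup_le fun i => ?_) (sup_le (sup_le ?_ ?_) ?_)
  · fin_cases i
    · exact le_sup_left.trans le_sup_left
    · exact le_sup_right.trans le_sup_left
    · exact le_sup_right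
  · exact le_iSup (fun i : Fin 3 => (![ψ, ψ.symm, idOn (e \ (ψ.dom ⊔ ψ.ran))] i) x) 0
  · exact le_iSup (fun i : Fin 3 => (![ψ, ψ.symm, idOn (e \ (ψ.dom ⊔ ψ.ran))] i) x) 1
  · exact le_iSup (fun i : Fin 3 => (![ψ, ψ.symm, idOn (e \ (ψ.dom ⊔ ψ.ran))] i) x) 2

theorem swap_symm : (swap e ψ h).symm = swap e ψ h := by
  refine ext fun x => ?_
  rw [swap_apply]
  refine le_antisymm (iSup_le fun i => ?_) (sup_le (sup_le ?_ ?_) ?_)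
  · fin_cases i
    · exact le_sup_right.trans le_sup_left
    · exact le_sup_left.trans le_sup_left
    · exact le_sup_right
  · exact le_iSup (fun i : Fin 3 => (![ψ, ψ.symm, idOn (e \ (ψ.dom ⊔ ψ.ran))] i).symm x) 1
  · exact le_iSup (fun i : Fin 3 => (![ψ, ψ.symm, idOn (e \ (ψ.dom ⊔ ψ.ran))] i).symm x) 0
  · exact le_iSup (fun i : Fin 3 => (![ψ, ψ.symm, idOn (e \ (ψ.dom ⊔ ψ.ran))] i).symm x) 2

theorem swap_ran (hd : ψ.dom ≤ e) (hr : ψ.ran ≤ e) : (swap e ψ h).ran = e := by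
  change swap e ψ h ⊤ = e
  rw [swap_apply, top_inf_eq]
  change ψ.ran ⊔ ψ.dom ⊔ _ = e
  rw [sup_comm ψ.ran, sup_sdiff_cancel_right (sup_le hd hr)]

theorem swap_dom (hd : ψ.dom ≤ e) (hr : ψ.ran ≤ e) : (swap e ψ h).dom = e := by
  rw [← ran_symm, swap_symm, swap_ran h hd hr]

theorem swap_apply_inf_dom (x : B) : swap e ψ h (x ⊓ ψ.dom) = ψ x := by
  have h1 : ψ.symm (x ⊓ ψ.dom) = ⊥ := by
    rw [apply_eq_bot, dom_symm, inf_assoc, h, inf_bot_eq]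
  have h2 : x ⊓ ψ.dom ⊓ (e \ (ψ.dom ⊔ ψ.ran)) = ⊥ :=
    (disjoint_sdiff_self_right.mono_left (inf_le_right.trans le_sup_left)).eq_bot
  rw [swap_apply, h1, h2, apply_inf_dom, sup_bot_eq, sup_bot_eq]

theorem swap_apply_inf_ran (x : B) : swap e ψ h (x ⊓ ψ.ran) = ψ.symm x := by
  have h1 : ψ (x ⊓ ψ.ran) = ⊥ := by
    rw [apply_eq_bot, inf_assoc, inf_comm ψ.ran, h, inf_bot_eq]
  have h2 : x ⊓ ψ.ran ⊓ (e \ (ψ.dom ⊔ ψ.ran)) = ⊥ :=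
    (disjoint_sdiff_self_right.mono_left (inf_le_right.trans le_sup_right)).eq_bot
  have h3 : ψ.symm (x ⊓ ψ.ran) = ψ.symm x := ψ.symm.apply_inf_dom x
  rw [swap_apply, h1, h2, h3, bot_sup_eq, sup_bot_eq]
end swap

end PIso

/-! ### Full pseudogroups -/

/-- A set of partial isomorphisms that contains the identities and is closed under inverses,
compositions and gluing. -/
structure FullPseudogroup (B : Type u) [CompleteBooleanAlgebra B] where
  carrier : Set (PIso B)
  idOn_mem : ∀ b, PIso.idOn b ∈ carrier
  symm_mem : ∀ {φ}, φ ∈ carrier → φ.symm ∈ carrier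
  trans_mem : ∀ {φ ψ}, φ ∈ carrier → ψ ∈ carrier → φ.trans ψ ∈ carrier
  of_local : ∀ φ : PIso B,
    (∀ y ≤ φ.dom, y ≠ ⊥ → ∃ x ≤ y, x ≠ ⊥ ∧ φ.restr x ∈ carrier) → φ ∈ carrier

namespace FullPseudogroup

variable {B : Type u} [CompleteBooleanAlgebra B] (P : FullPseudogroup B)

theorem restr_mem {φ : PIso B} (h : φ ∈ P.carrier) (b : B) : φ.restr b ∈ P.carrier :=
  P.trans_mem (P.idOn_mem b) h

theorem glue_mem {ι : Type*} (φ : ι → PIso B) (hd : ∀ i j, i ≠ j → (φ i).dom ⊓ (φ j).dom = ⊥)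
    (hr : ∀ i j, i ≠ j → (φ i).ran ⊓ (φ j).ran = ⊥) (h : ∀ i, φ i ∈ P.carrier) :
    PIso.glue φ hd hr ∈ P.carrier := by
  refine P.of_local _ fun y hy hy0 => ?_
  rw [PIso.glue_dom] at hy
  have : ∃ i, y ⊓ (φ i).dom ≠ ⊥ := by
    by_contra! hc
    apply hy0
    rw [← inf_eq_left.2 hy, inf_iSup_eq]
    simp [hc]
  obtain ⟨i, hi⟩ := this
  refine ⟨y ⊓ (φ i).dom, inf_le_left, hi, ?_⟩
  rw [inf_comm, ← PIso.restr_restr, PIso.glue_restr_dom]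
  exact P.restr_mem (h i) _

theorem swap_mem {e : B} {ψ : PIso B} (h : ψ.dom ⊓ ψ.ran = ⊥) (hψ : ψ ∈ P.carrier) :
    PIso.swap e ψ h ∈ P.carrier := by
  refine P.glue_mem _ _ _ fun i => ?_
  fin_cases i
  exacts [hψ, P.symm_mem hψ, P.idOn_mem _]

/-- The group of automorphisms of the principal ideal below `e`. -/
def grp (e : B) : Set (PIso B) := {φ | φ ∈ P.carrier ∧ φ.dom = e ∧ φ.ran = e}

/-- The partial isomorphisms from a part of `x` to a part of `y`. -/
def hom (x y : B) : Set (PIso B) := {φ | φ ∈ P.carrier ∧ φ.dom ≤ x ∧ φ.ran ≤ y}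

/-- The partial isomorphisms with domain disjoint from the range. -/
def disj : Set (PIso B) := {φ | φ ∈ P.carrier ∧ φ.dom ⊓ φ.ran = ⊥}

/-- The automorphisms that are their own inverse. -/
def inv : Set (PIso B) := {φ | φ ∈ P.grp ⊤ ∧ φ.symm = φ}

end FullPseudogroup

/-! ### Moved pieces, and what an involution remembers -/

namespace PIso
variable {B : Type u} [CompleteBooleanAlgebra B]

/-- If `y \ φ y` is nonzero it is moved off itself, since its image lies below `φ y`. Otherwise `y <
φ y`, and the preimage of `φ y \ y` will do. -/
theorem exists_moved (φ : PIso B) {y : B} (h : φ y ≠ y) :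
    ∃ w ≤ y, w ≠ ⊥ ∧ φ w ⊓ w = ⊥ := by
  by_cases h1 : y \ φ y = ⊥
  · have h2 : φ y \ y ≠ ⊥ := fun h2 =>
      h (le_antisymm (sdiff_eq_bot_iff.1 h2) (sdiff_eq_bot_iff.1 h1))
    have hr : φ y \ y ≤ φ.ran := sdiff_le.trans (φ.apply_le_ran y)
    have hw : φ.symm (φ y \ y) ≤ y := by
      refine (φ.symm.mono sdiff_le).trans ?_
      rw [symm_apply_apply]; exact inf_le_left
    refine ⟨φ.symm (φ y \ y), hw, φ.symm.apply_ne_bot hr h2, ?_⟩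
    rw [apply_symm_apply_of_le _ hr]
    exact (disjoint_sdiff_self_left.mono_right hw).eq_bot
  · exact ⟨y \ φ y, sdiff_le, h1,
      (disjoint_sdiff_self_right.mono_left (φ.mono sdiff_le)).eq_bot⟩

theorem exists_maximal_moved (φ : PIso B) :
    ∃ x, Maximal (fun x => x ≤ φ.dom ∧ φ x ⊓ x = ⊥) x := by
  refine zorn_le₀ {x | x ≤ φ.dom ∧ φ x ⊓ x = ⊥} fun c hc hchain =>
    ⟨sSup c, ⟨sSup_le fun x hx => (hc hx).1, ?_⟩, fun x hx => le_sSup hx⟩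
  rw [PIso.map_sSup, ← le_bot_iff]
  simp only [iSup_inf_eq, inf_sSup_eq, iSup_le_iff]
  intro x hx y hy
  rcases hchain.total hx hy with h | h
  · exact (inf_le_inf_left _ h).trans (hc hy).2.le
  · exact (inf_le_inf_right _ (φ.mono h)).trans (hc hx).2.le

/-- Every partial isomorphism is the identity off three pieces which it moves to elements disjoint
from them. -/
theorem exists_three_pieces (φ : PIso B) : ∃ u : Fin 3 → B,
    (∀ i, u i ≤ φ.dom ∧ φ (u i) ⊓ u i = ⊥) ∧
      ∀ y ≤ φ.dom, y ⊓ (u 0 ⊔ u 1 ⊔ u 2) = ⊥ → φ y = y := by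
  obtain ⟨x, ⟨hx, hx0⟩, hmax⟩ := φ.exists_maximal_moved
  -- Let w be moved off itself and disjoint from all three pieces. Disjointness from the preimage
  -- and from the image of x makes `x ⊔ w` moved off itself too, against maximality.
  refine ⟨![x, φ.symm x, φ x ⊓ φ.dom], ?_, ?_⟩
  · intro i
    fin_cases i
    · exact ⟨hx, hx0⟩
    · refine ⟨φ.symm_apply_le_dom x, ?_⟩
      change φ (φ.symm x) ⊓ φ.symm x = ⊥
      rw [apply_symm_apply, ← le_bot_iff]
      calc x ⊓ φ.ran ⊓ φ.symm x ≤ φ.symm (φ x) ⊓ φ.symm x := by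
            rw [symm_apply_apply, inf_eq_left.2 hx]; exact inf_le_inf_right _ inf_le_left
        _ = ⊥ := φ.symm.disjoint_apply hx0
    · refine ⟨inf_le_right, ?_⟩
      change φ (φ x ⊓ φ.dom) ⊓ (φ x ⊓ φ.dom) = ⊥
      rw [apply_inf_dom, ← le_bot_iff, ← φ.disjoint_apply hx0]
      exact inf_le_inf_left _ inf_le_left
  · intro y hy hd
    change y ⊓ (x ⊔ φ.symm x ⊔ φ x ⊓ φ.dom) = ⊥ at hd
    by_contra hne
    obtain ⟨w, hwy, hw, hww⟩ := φ.exists_moved hne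
    have hd' : w ⊓ (x ⊔ φ.symm x ⊔ φ x ⊓ φ.dom) = ⊥ :=
      le_bot_iff.1 ((inf_le_inf_right _ hwy).trans hd.le)
    rw [inf_sup_left, inf_sup_left, sup_eq_bot_iff, sup_eq_bot_iff] at hd'
    obtain ⟨⟨h1, h2⟩, h3⟩ := hd'
    have h4 : φ w ⊓ x = ⊥ := by
      have := φ.disjoint_apply h2
      rwa [apply_symm_apply, inf_comm x, ← inf_assoc, inf_eq_left.2 (φ.apply_le_ran w)] at this
    have h5 : φ x ⊓ w = ⊥ := by
      rw [← inf_eq_left.2 (hwy.trans hy), inf_comm w, ← inf_assoc, inf_comm, h3]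
    have h6 : x ⊔ w ≤ x := hmax ⟨sup_le hx (hwy.trans hy), by
      rw [PIso.map_sup, inf_sup_left, inf_sup_right, inf_sup_right, hx0, h4, h5, hww]; simp⟩ le_sup_left
    apply hw
    rw [← h1, inf_eq_left.2 (le_sup_right.trans h6)]

theorem eq_of_restr_eq {φ ψ : PIso B} {u v : Fin 3 → B} (hdom : φ.dom = ψ.dom)
    (hu : ∀ i, u i ≤ φ.dom) (hv : ∀ i, v i ≤ ψ.dom)
    (hφ : ∀ y ≤ φ.dom, y ⊓ (u 0 ⊔ u 1 ⊔ u 2) = ⊥ → φ y = y)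
    (hψ : ∀ y ≤ ψ.dom, y ⊓ (v 0 ⊔ v 1 ⊔ v 2) = ⊥ → ψ y = y)
    (h : ∀ i, φ.restr (u i) = ψ.restr (v i)) : φ = ψ := by
  have huv : u = v := funext fun i => by
    have := congrArg dom (h i)
    rwa [restr_dom, restr_dom, inf_eq_right.2 (hu i), inf_eq_right.2 (hv i)] at this
  subst huv
  refine ext fun z => ?_
  have hz : z ⊓ φ.dom = z ⊓ φ.dom ⊓ u 0 ⊔ z ⊓ φ.dom ⊓ u 1 ⊔ z ⊓ φ.dom ⊓ u 2 ⊔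
      (z ⊓ φ.dom) \ (u 0 ⊔ u 1 ⊔ u 2) := by
    rw [← inf_sup_left, ← inf_sup_left, sup_inf_sdiff]
  have hi : ∀ i, φ (z ⊓ φ.dom ⊓ u i) = ψ (z ⊓ φ.dom ⊓ u i) := fun i => by
    rw [← restr_apply, h i, restr_apply]
  have hr : φ ((z ⊓ φ.dom) \ (u 0 ⊔ u 1 ⊔ u 2)) = ψ ((z ⊓ φ.dom) \ (u 0 ⊔ u 1 ⊔ u 2)) := by
    have h1 : (z ⊓ φ.dom) \ (u 0 ⊔ u 1 ⊔ u 2) ≤ φ.dom := sdiff_le.trans inf_le_right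
    rw [hφ _ h1 inf_sdiff_self_left, hψ _ (hdom ▸ h1) inf_sdiff_self_left]
  rw [← φ.apply_inf_dom, ← ψ.apply_inf_dom, ← hdom, hz]
  simp only [PIso.map_sup, hi, hr]

/-- The swap of ψ fixes whatever is disjoint from the domain and range of ψ, while the swap of φ
sends parts of its domain into its range, which is disjoint from it, and back. -/
theorem support_le_of_swap_eq {φ ψ : PIso B} (hφ : φ.dom ⊓ φ.ran = ⊥) (hψ : ψ.dom ⊓ ψ.ran = ⊥)
    (h : swap ⊤ φ hφ = swap ⊤ ψ hψ) : φ.dom ⊔ φ.ran ≤ ψ.dom ⊔ ψ.ran := by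
  have hfix : ∀ x, x ⊓ (ψ.dom ⊔ ψ.ran) = ⊥ → swap ⊤ φ hφ x = x := by
    intro x hx
    rw [inf_sup_left, sup_eq_bot_iff] at hx
    rw [h, swap_apply, (ψ.apply_eq_bot).2 hx.1, (ψ.symm.apply_eq_bot).2 hx.2, top_sdiff,
      sup_bot_eq, bot_sup_eq, inf_eq_left, le_compl_iff_disjoint_right, disjoint_iff,
      inf_sup_left, hx.1, hx.2, sup_bot_eq]
  refine sup_le ?_ ?_ <;> rw [← sdiff_eq_bot_iff]
  · have h1 := hfix (φ.dom \ (ψ.dom ⊔ ψ.ran)) inf_sdiff_self_left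
    rw [← inf_eq_left.2 (sdiff_le : φ.dom \ (ψ.dom ⊔ ψ.ran) ≤ φ.dom), swap_apply_inf_dom,
      inf_eq_left.2 sdiff_le] at h1
    rw [← le_bot_iff, ← hφ]
    exact le_inf sdiff_le (h1 ▸ φ.apply_le_ran _)
  · have h1 := hfix (φ.ran \ (ψ.dom ⊔ ψ.ran)) inf_sdiff_self_left
    rw [← inf_eq_left.2 (sdiff_le : φ.ran \ (ψ.dom ⊔ ψ.ran) ≤ φ.ran), swap_apply_inf_ran,
      inf_eq_left.2 sdiff_le] at h1
    rw [← le_bot_iff, ← hφ]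
    exact le_inf (h1 ▸ φ.symm.apply_le_ran _) sdiff_le

/-- Domain and range have the same join for φ and ρ. So what `ρ.dom` has outside `φ.dom` lies in
`φ.ran`, and the common involution carries it to the part of `φ.dom` in `ρ.ran`. -/
theorem dom_eq_of_swap_eq {φ ρ : PIso B} (hφ : φ.dom ⊓ φ.ran = ⊥) (hρ : ρ.dom ⊓ ρ.ran = ⊥)
    (h : swap ⊤ φ hφ = swap ⊤ ρ hρ) :
    φ.dom = φ.dom ⊓ ρ.dom ⊔ swap ⊤ ρ hρ (ρ.dom \ (φ.dom ⊓ ρ.dom)) := by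
  have h1 : ρ.dom \ (φ.dom ⊓ ρ.dom) = ρ.dom ⊓ φ.ran := by
    rw [sdiff_inf_self_right]
    refine le_antisymm (le_inf sdiff_le ?_) (le_sdiff.2 ⟨inf_le_left, ?_⟩)
    · rw [sdiff_le_iff]
      exact le_sup_left.trans (support_le_of_swap_eq hρ hφ h.symm)
    · exact (disjoint_iff.2 hφ).symm.mono_left inf_le_right
  have h2 : swap ⊤ ρ hρ ρ.dom = ρ.ran := by
    rw [← top_inf_eq ρ.dom, swap_apply_inf_dom]; rfl
  have h3 : swap ⊤ ρ hρ φ.ran = φ.dom := by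
    rw [← h, ← top_inf_eq φ.ran, swap_apply_inf_ran]; rfl
  rw [h1, PIso.map_inf, h2, h3, inf_comm ρ.ran, ← inf_sup_left, eq_comm, inf_eq_left]
  exact le_sup_left.trans (support_le_of_swap_eq hφ hρ h)

/-- The image of `ψ.restr ρ.dom` lies in `ρ.ran`, so within `ρ.dom` the support of its swap shows
only its domain. -/
theorem dom_inf_le_of_swap_restr_eq {φ ψ ρ : PIso B}
    (hρ : ρ.dom ⊓ ρ.ran = ⊥) (hψρ : ∀ x, ψ x ≤ swap ⊤ ρ hρ x)
    (h1 : (φ.restr ρ.dom).dom ⊓ (φ.restr ρ.dom).ran = ⊥)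
    (h2 : (ψ.restr ρ.dom).dom ⊓ (ψ.restr ρ.dom).ran = ⊥)
    (h : swap ⊤ _ h1 = swap ⊤ _ h2) : φ.dom ⊓ ρ.dom ≤ ψ.dom ⊓ ρ.dom := by
  have h3 := le_sup_left.trans (support_le_of_swap_eq h1 h2 h)
  have h4 : ψ ρ.dom ≤ ρ.ran := (hψρ _).trans_eq (by
    rw [← top_inf_eq ρ.dom, swap_apply_inf_dom]; rfl)
  rw [restr_dom, restr_dom, restr_ran] at h3
  have h5 := le_inf h3 (inf_le_right : φ.dom ⊓ ρ.dom ≤ ρ.dom)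
  rw [inf_sup_right] at h5
  refine h5.trans (sup_le inf_le_left ?_)
  refine (inf_le_inf_right _ h4).trans ?_
  rw [inf_comm, hρ]; exact bot_le

theorem eq_of_swap_eq {e : B} {φ ψ : PIso B} (hφ : φ.dom ⊓ φ.ran = ⊥) (hψ : ψ.dom ⊓ ψ.ran = ⊥)
    (h : swap e φ hφ = swap e ψ hψ) (hd : φ.dom = ψ.dom) : φ = ψ :=
  ext fun x => by
    rw [← swap_apply_inf_dom hφ (e := e), h, hd, swap_apply_inf_dom]

theorem apply_le_swap {φ : PIso B} (hφ : φ.dom ⊓ φ.ran = ⊥) (x : B) : φ x ≤ swap ⊤ φ hφ x := by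
  rw [← swap_apply_inf_dom hφ (e := ⊤)]
  exact (swap ⊤ φ hφ).mono inf_le_left

end PIso

/-! ### Inequalities between the numbers of partial isomorphisms, automorphisms and involutions -/

namespace FullPseudogroup
open PIso
variable {B : Type u} [CompleteBooleanAlgebra B] (P : FullPseudogroup B)

theorem mk_carrier_le : #P.carrier ≤ #P.disj ^ 3 * #B := by
  choose u hu hid using fun φ : PIso B => φ.exists_three_pieces
  have hmem : ∀ (φ : P.carrier) i, φ.1.restr (u φ.1 i) ∈ P.disj := fun φ i => by
    refine ⟨P.restr_mem φ.2 _, ?_⟩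
    rw [restr_dom, restr_ran, inf_eq_right.2 (hu φ.1 i).1, inf_comm, (hu φ.1 i).2]
  have := mk_le_of_injective (f := fun φ : P.carrier =>
    ((fun i : Fin 3 => (⟨φ.1.restr (u φ.1 i), hmem φ i⟩ : P.disj)), φ.1.dom)) (by
      intro φ ψ h
      rw [Prod.mk.injEq] at h
      exact Subtype.ext (eq_of_restr_eq h.2 (fun i => (hu _ i).1) (fun i => (hu _ i).1)
        (hid _) (hid _) fun i => congrArg Subtype.val (congrFun h.1 i)))
  have h3 : #(Fin 3 → P.disj) = #P.disj ^ 3 := by simp [← power_natCast]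
  rwa [mk_prod, lift_id, lift_id, h3] at this

/-- As in `mk_carrier_le`, but the domain is always ⊤ and need not be recorded. -/
theorem mk_grp_le : #(P.grp ⊤) ≤ #P.disj ^ 3 := by
  choose u hu hid using fun φ : PIso B => φ.exists_three_pieces
  have hmem : ∀ (φ : P.grp ⊤) i, φ.1.restr (u φ.1 i) ∈ P.disj := fun φ i => by
    refine ⟨P.restr_mem φ.2.1 _, ?_⟩
    rw [restr_dom, restr_ran, inf_eq_right.2 (hu φ.1 i).1, inf_comm, (hu φ.1 i).2]
  have := mk_le_of_injective (f := fun φ : P.grp ⊤ =>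
    (fun i : Fin 3 => (⟨φ.1.restr (u φ.1 i), hmem φ i⟩ : P.disj))) (by
      intro φ ψ h
      exact Subtype.ext (eq_of_restr_eq (φ.2.2.1.trans ψ.2.2.1.symm) (fun i => (hu _ i).1)
        (fun i => (hu _ i).1) (hid _) (hid _) fun i => congrArg Subtype.val (congrFun h i)))
  have h3 : #(Fin 3 → P.disj) = #P.disj ^ 3 := by simp [← power_natCast]
  rwa [h3] at this

theorem swap_mem_inv {ψ : PIso B} (h : ψ ∈ P.disj) : swap ⊤ ψ h.2 ∈ P.inv :=
  ⟨⟨P.swap_mem h.2 h.1, swap_dom _ le_top le_top, swap_ran _ le_top le_top⟩, swap_symm _⟩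

theorem mk_disj_le : #P.disj ≤ #P.inv * #B := by
  have := mk_le_of_injective (f := fun ψ : P.disj =>
    ((⟨swap ⊤ ψ.1 ψ.2.2, P.swap_mem_inv ψ.2⟩ : P.inv), ψ.1.dom)) (by
      intro φ ψ h
      rw [Prod.mk.injEq, Subtype.mk.injEq] at h
      exact Subtype.ext (eq_of_swap_eq φ.2.2 ψ.2.2 h.1 h.2))
  simpa using this

/-- The swap of ψ forgets which half is the domain. Fix for every swap a reference ρ with that swap.
The swap of `ψ.restr ρ.dom` then tells which part of `ρ.dom` belongs to `ψ.dom`, and this determines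
`ψ.dom`. So the factor `#B` of `mk_disj_le` can be replaced by the number of involutions. -/
theorem mk_disj_le_inv : #P.disj ≤ #P.inv * #P.inv := by
  let sw : P.disj → P.inv := fun ψ => ⟨swap ⊤ ψ.1 ψ.2.2, P.swap_mem_inv ψ.2⟩
  let ref : P.disj → P.disj := fun ψ => Set.rangeSplitting sw ⟨sw ψ, ψ, rfl⟩
  have href : ∀ ψ, swap ⊤ ψ.1 ψ.2.2 = swap ⊤ (ref ψ).1 (ref ψ).2.2 := fun ψ =>
    congrArg Subtype.val (Set.apply_rangeSplitting sw ⟨sw ψ, ψ, rfl⟩).symm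
  have hres : ∀ ψ : P.disj, ψ.1.restr (ref ψ).1.dom ∈ P.disj := fun ψ => by
    refine ⟨P.restr_mem ψ.2.1 _, le_bot_iff.1 ?_⟩
    rw [← ψ.2.2, restr_dom, restr_ran]
    exact inf_le_inf inf_le_left (apply_le_ran _ _)
  refine (mk_le_of_injective (f := fun ψ : P.disj => (sw ψ, sw ⟨_, hres ψ⟩)) ?_).trans_eq
    (by simp)
  intro φ ψ h
  obtain ⟨h1, h2⟩ := Prod.mk.inj h
  have hrf : ref ψ = ref φ := by
    simp only [ref]; congr 1; exact Subtype.ext h1.symm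
  have h3 := congrArg Subtype.val h2
  have hψ' := hres ψ
  have hψref := href ψ
  rw [hrf] at hψref hψ'
  replace h3 : swap ⊤ _ (hres φ).2 = swap ⊤ _ hψ'.2 := by
    refine Eq.trans h3 ?_
    simp only [sw, hrf]
  have hle : ∀ χ : P.disj, swap ⊤ χ.1 χ.2.2 = swap ⊤ (ref φ).1 (ref φ).2.2 →
      ∀ x, χ.1 x ≤ swap ⊤ (ref φ).1 (ref φ).2.2 x := fun χ h x => by
    rw [← h]; exact apply_le_swap _ x
  have h4 : φ.1.dom ⊓ (ref φ).1.dom = ψ.1.dom ⊓ (ref φ).1.dom := le_antisymm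
    (dom_inf_le_of_swap_restr_eq (ref φ).2.2 (hle ψ hψref) _ _ h3)
    (dom_inf_le_of_swap_restr_eq (ref φ).2.2 (hle φ (href φ)) _ _ h3.symm)
  have h5 : φ.1.dom = ψ.1.dom := by
    rw [dom_eq_of_swap_eq φ.2.2 (ref φ).2.2 (href φ), h4,
      ← dom_eq_of_swap_eq ψ.2.2 (ref φ).2.2 hψref]
  exact Subtype.ext (eq_of_swap_eq φ.2.2 ψ.2.2 (congrArg Subtype.val h1) h5)

theorem idOn_mem_grp (e : B) : idOn e ∈ P.grp e := ⟨P.idOn_mem e, idOn_dom e, idOn_ran e⟩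

theorem mk_grp_pos (e : B) : 1 ≤ #(P.grp e) :=
  Cardinal.one_le_iff_ne_zero.2 (mk_ne_zero_iff.2 ⟨⟨_, P.idOn_mem_grp e⟩⟩)

theorem prod_mk_hom_le {ι : Type u} (x : ι → B) (hx : ∀ i j, i ≠ j → x i ⊓ x j = ⊥) {e : B}
    (he : ∀ i, x i ≤ e) : prod (fun i => #(P.hom (x i) (x i))) ≤ #(P.hom e e) := by
  have hle : ∀ {a b : ι → B}, (∀ i, a i ≤ x i) → (∀ i, b i ≤ x i) →
      ∀ i j, i ≠ j → a i ⊓ b j = ⊥ := fun h h' i j hij =>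
    le_bot_iff.1 ((inf_le_inf (h i) (h' j)).trans (hx i j hij).le)
  rw [← mk_pi]
  refine mk_le_of_injective (f := fun φ : ∀ i, P.hom (x i) (x i) =>
    (⟨glue (fun i => (φ i).1) (hle (fun i => (φ i).2.2.1) fun i => (φ i).2.2.1)
      (hle (fun i => (φ i).2.2.2) fun i => (φ i).2.2.2), P.glue_mem _ _ _ fun i => (φ i).2.1,
      iSup_le fun i => (φ i).2.2.1.trans (he i), iSup_le fun i => (φ i).2.2.2.trans (he i)⟩ :
      P.hom e e)) ?_
  intro φ ψ h
  refine funext fun i => Subtype.ext (PIso.ext fun z => ?_)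
  have h1 := congrArg (fun χ : P.hom e e => χ.1 (z ⊓ x i)) h
  have key : ∀ χ : ∀ i, P.hom (x i) (x i), (χ i).1 (z ⊓ x i) = (χ i).1 z := fun χ => by
    rw [← (χ i).1.apply_inf_dom, inf_assoc, inf_eq_right.2 (χ i).2.2.1, apply_inf_dom]
  have key' : ∀ χ : ∀ i, P.hom (x i) (x i), ∀ j, j ≠ i → z ⊓ x i ⊓ (χ j).1.dom = ⊥ :=
    fun χ j hj => le_bot_iff.1 <| (inf_le_inf inf_le_right (χ j).2.2.1).trans
      (hx i j hj.symm).le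
  simp only at h1
  rw [glue_apply_of_le _ _ _ i (key' φ), glue_apply_of_le _ _ _ i (key' ψ), key, key] at h1
  exact h1

theorem prod_mk_grp_le {ι : Type u} (x : ι → B) (hx : ∀ i j, i ≠ j → x i ⊓ x j = ⊥) :
    prod (fun i => #(P.grp (x i))) ≤ #(P.grp (⨆ i, x i)) := by
  rw [← mk_pi]
  refine mk_le_of_injective (f := fun φ : ∀ i, P.grp (x i) =>
    (⟨glue (fun i => (φ i).1) (fun i j h => by rw [(φ i).2.2.1, (φ j).2.2.1, hx i j h])
      (fun i j h => by rw [(φ i).2.2.2, (φ j).2.2.2, hx i j h]),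
      P.glue_mem _ _ _ fun i => (φ i).2.1,
      iSup_congr fun i => (φ i).2.2.1, iSup_congr fun i => (φ i).2.2.2⟩ :
      P.grp (⨆ i, x i))) ?_
  intro φ ψ h
  refine funext fun i => Subtype.ext ?_
  have h1 := congrArg (fun χ : P.grp (⨆ i, x i) => χ.1.restr (x i)) h
  have h2 := glue_restr_dom _
    (fun i j h => by rw [(φ i).2.2.1, (φ j).2.2.1, hx i j h])
    (fun i j h => by rw [(φ i).2.2.2, (φ j).2.2.2, hx i j h]) i
  have h3 := glue_restr_dom _
    (fun i j h => by rw [(ψ i).2.2.1, (ψ j).2.2.1, hx i j h])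
    (fun i j h => by rw [(ψ i).2.2.2, (ψ j).2.2.2, hx i j h]) i
  rw [(φ i).2.2.1] at h2
  rw [(ψ i).2.2.1] at h3
  rw [← h2, ← h3]
  exact h1

theorem mk_grp_mono {x e : B} (h : x ≤ e) : #(P.grp x) ≤ #(P.grp e) := by
  let y : ULift.{u} Bool → B := fun b => bif b.down then x else e \ x
  have hy : ∀ i j, i ≠ j → y i ⊓ y j = ⊥ := by
    rintro ⟨i⟩ ⟨j⟩ hij
    cases i <;> cases j <;> simp_all [y]
  have hs : ⨆ i, y i = e := by
    refine le_antisymm (iSup_le ?_) ?_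
    · rintro ⟨i⟩; cases i
      exacts [sdiff_le, h]
    · rw [← sup_sdiff_cancel_right h]
      exact sup_le (le_iSup y ⟨true⟩) (le_iSup y ⟨false⟩)
  have h1 := P.prod_mk_grp_le y hy
  rw [hs] at h1
  refine le_trans ?_ h1
  rw [← mk_pi]
  classical
  refine mk_le_of_injective (f := fun φ : P.grp x => fun i : ULift.{u} Bool =>
    (if hi : x = y i then ⟨φ.1, hi ▸ φ.2⟩ else ⟨_, P.idOn_mem_grp _⟩ : P.grp (y i))) ?_
  intro φ ψ h
  have h2 := congrFun h ⟨true⟩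
  have h3 : x = y ⟨true⟩ := rfl
  simp only [dif_pos h3, Subtype.mk.injEq] at h2
  exact Subtype.ext h2

/-- An automorphism is the join of its matrix entries, the parts that go from `x i` into `x j`. -/
theorem mk_grp_le_prod {ι : Type u} (x : ι → B) :
    #(P.grp (⨆ i, x i)) ≤ prod fun p : ι × ι => #(P.hom (x p.1) (x p.2)) := by
  rw [← mk_pi]
  have hmem : ∀ (φ : P.grp (⨆ i, x i)) (p : ι × ι),
      (φ.1.restr (x p.1)).trans (idOn (x p.2)) ∈ P.hom (x p.1) (x p.2) := fun φ p =>
    ⟨P.trans_mem (P.restr_mem φ.2.1 _) (P.idOn_mem _), by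
      rw [trans_dom]
      exact (symm_apply_le_dom _ _).trans ((restr_dom _ _).trans_le inf_le_right), by
      rw [trans_ran]
      exact (apply_le_ran _ _).trans (idOn_ran _).le⟩
  refine mk_le_of_injective (f := fun (φ : P.grp (⨆ i, x i)) p => ⟨_, hmem φ p⟩) ?_
  have key : ∀ (φ : P.grp (⨆ i, x i)) z, φ.1 z =
      ⨆ i, ⨆ j, ((φ.1.restr (x i)).trans (idOn (x j))) z := fun φ z => by
    simp only [trans_apply, restr_apply, idOn_apply]
    simp only [← inf_iSup_eq, ← iSup_inf_eq]
    rw [← PIso.map_iSup, ← inf_iSup_eq]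
    have h1 : z ⊓ ⨆ i, x i = z ⊓ φ.1.dom := by rw [φ.2.2.1]
    rw [h1, apply_inf_dom, eq_comm, inf_eq_left]
    exact (apply_le_ran _ _).trans φ.2.2.2.le
  intro φ ψ h
  refine Subtype.ext (PIso.ext fun z => ?_)
  rw [key, key]
  refine iSup_congr fun i => iSup_congr fun j => ?_
  exact congrArg (fun χ : P.hom (x i) (x j) => χ.1 z) (congrFun h (i, j))

theorem mk_hom_le_of_equiv {x y x' y' : B} {θ η : PIso B} (hθ : θ ∈ P.carrier)
    (hη : η ∈ P.carrier) (hx : θ.dom = x) (hx' : θ.ran ≤ x') (hy : η.dom = y) (hy' : η.ran ≤ y') :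
    #(P.hom x y) ≤ #(P.hom x' y') := by
  refine mk_le_of_injective (f := fun φ : P.hom x y =>
    (⟨(θ.symm.trans φ.1).trans η, P.trans_mem (P.trans_mem (P.symm_mem hθ) φ.2.1) hη,
      (apply_le_ran θ _).trans hx', (apply_le_ran η _).trans hy'⟩ : P.hom x' y')) ?_
  intro φ ψ h
  have key : ∀ χ : P.hom x y, ∀ z, χ.1 z = η.symm (((θ.symm.trans χ.1).trans η) (θ z)) :=
    fun χ z => by
      simp only [trans_apply, symm_apply_apply]
      rw [hx, hy, inf_eq_left.2 ((apply_le_ran _ _).trans χ.2.2.2), ← χ.1.apply_inf_dom (z ⊓ x),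
        inf_assoc, inf_eq_right.2 χ.2.2.1, apply_inf_dom]
  refine Subtype.ext (PIso.ext fun z => ?_)
  rw [key, key]
  exact congrArg (fun χ : P.hom x' y' => η.symm (χ.1 (θ z))) h

/-- A disjoint copy v of u gives room to turn a partial isomorphism φ of u into an involution below
e: swap along `φ.trans ρ`. Restricting the swap to u and cutting its values to v gives `φ.trans ρ`
back. -/
theorem mk_hom_le_grp {u v e : B} (hu : u ≤ e) (hv : v ≤ e) (huv : u ⊓ v = ⊥) {ρ : PIso B}
    (hρ : ρ ∈ P.carrier) (hd : ρ.dom = u) (hr : ρ.ran = v) : #(P.hom u u) ≤ #(P.grp e) := by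
  have hdom : ∀ φ : P.hom u u, (φ.1.trans ρ).dom ≤ u := fun φ =>
    (symm_apply_le_dom φ.1 _).trans φ.2.2.1
  have hran : ∀ φ : P.hom u u, (φ.1.trans ρ).ran ≤ v := fun φ =>
    (apply_le_ran ρ _).trans hr.le
  have hdis : ∀ φ : P.hom u u, (φ.1.trans ρ).dom ⊓ (φ.1.trans ρ).ran = ⊥ := fun φ =>
    le_bot_iff.1 ((inf_le_inf (hdom φ) (hran φ)).trans huv.le)
  refine mk_le_of_injective (f := fun φ : P.hom u u =>
    (⟨swap e _ (hdis φ), P.swap_mem _ (P.trans_mem φ.2.1 hρ),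
      swap_dom _ ((hdom φ).trans hu) ((hran φ).trans hv),
      swap_ran _ ((hdom φ).trans hu) ((hran φ).trans hv)⟩ : P.grp e)) ?_
  intro φ ψ h
  have key : ∀ χ : P.hom u u, ∀ z, χ.1 z = ρ.symm (swap e _ (hdis χ) (z ⊓ u) ⊓ v) := fun χ z => by
    have h1 : z ⊓ u ⊓ (e \ ((χ.1.trans ρ).dom ⊔ (χ.1.trans ρ).ran)) ⊓ v = ⊥ := by
      rw [← le_bot_iff, ← huv]
      exact inf_le_inf_right _ (inf_le_left.trans inf_le_right)
    have h2 : (χ.1.trans ρ).symm (z ⊓ u) = ⊥ := by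
      rw [apply_eq_bot, dom_symm, inf_assoc, ← le_bot_iff, ← huv]
      exact inf_le_right.trans (inf_le_inf_left _ (hran χ))
    rw [swap_apply, h2, sup_bot_eq, inf_sup_right, h1, sup_bot_eq, ← hr,
      trans_apply, inf_eq_left.2 (apply_le_ran ρ _), symm_apply_apply, hd,
      inf_eq_left.2 ((apply_le_ran _ _).trans χ.2.2.2), ← χ.1.apply_inf_dom (z ⊓ u),
        inf_assoc, inf_eq_right.2 χ.2.2.1, apply_inf_dom]
  refine Subtype.ext (PIso.ext fun z => ?_)
  rw [key, key]
  exact congrArg (fun χ : P.grp e => ρ.symm (χ.1 (z ⊓ u) ⊓ v)) h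

/-! ### Invariant elements -/

/-- The elements that every partial isomorphism in `P` maps below themselves. -/
def central : Set B := {e | ∀ φ ∈ P.carrier, φ e ≤ e}

variable {P} in
theorem central_compl {e : B} (h : e ∈ P.central) : eᶜ ∈ P.central := by
  intro φ hφ
  rw [le_compl_iff_disjoint_right, disjoint_iff]
  have h1 : φ.symm (φ eᶜ ⊓ e) = ⊥ := by
    rw [PIso.map_inf, symm_apply_apply, ← le_bot_iff, ← inf_compl_eq_bot (a := e), inf_comm e]
    exact inf_le_inf inf_le_left (h _ (P.symm_mem hφ))
  rwa [apply_eq_bot, inf_eq_left.2 (inf_le_left.trans (apply_le_ran _ _))] at h1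

theorem iSup_mem_central {ι : Sort*} {f : ι → B} (h : ∀ i, f i ∈ P.central) :
    ⨆ i, f i ∈ P.central := by
  intro φ hφ
  rw [PIso.map_iSup]
  exact iSup_mono fun i => h i φ hφ

theorem sSup_mem_central {s : Set B} (h : s ⊆ P.central) : sSup s ∈ P.central := by
  rw [sSup_eq_iSup']
  exact P.iSup_mem_central fun i => h i.2

variable {P} in
theorem central_inf {e f : B} (h : e ∈ P.central) (h' : f ∈ P.central) : e ⊓ f ∈ P.central :=
  fun φ hφ => (φ.map_inf e f).le.trans (inf_le_inf (h φ hφ) (h' φ hφ))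

variable {P} in
theorem central_sdiff {e f : B} (h : e ∈ P.central) (h' : f ∈ P.central) : e \ f ∈ P.central := by
  rw [sdiff_eq]; exact central_inf h (central_compl h')

theorem top_mem_central : ⊤ ∈ P.central := fun _ _ => le_top

theorem hull_mem_central (x : B) : (⨆ φ : P.carrier, φ.1 x) ∈ P.central := by
  intro ψ hψ
  rw [PIso.map_iSup]
  exact iSup_le fun φ => le_iSup (fun χ : P.carrier => χ.1 x) ⟨_, P.trans_mem φ.2 hψ⟩

theorem le_hull (x : B) : x ≤ ⨆ φ : P.carrier, φ.1 x := by
  refine le_trans ?_ (le_iSup (fun φ : P.carrier => φ.1 x) ⟨_, P.idOn_mem ⊤⟩)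
  simp

/-- An automorphism maps each central element onto itself, so only the diagonal entries of its
matrix remain. -/
theorem mk_grp_top_le_prod {ι : Type u} (x : ι → B) (hx : ∀ i, x i ∈ P.central)
    (hs : ⨆ i, x i = ⊤) : #(P.grp ⊤) ≤ prod fun i => #(P.grp (x i)) := by
  rw [← mk_pi]
  have hmem : ∀ (φ : P.grp ⊤) i, φ.1.restr (x i) ∈ P.grp (x i) := fun φ i => by
    refine ⟨P.restr_mem φ.2.1 _, by rw [restr_dom, φ.2.2.1, top_inf_eq], ?_⟩
    rw [restr_ran]
    refine le_antisymm (hx i _ φ.2.1) ?_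
    have h1 := φ.1.mono (hx i _ (P.symm_mem φ.2.1))
    rwa [apply_symm_apply, φ.2.2.2, inf_top_eq] at h1
  refine mk_le_of_injective (f := fun (φ : P.grp ⊤) i => ⟨_, hmem φ i⟩) ?_
  have key : ∀ (φ : P.grp ⊤) z, φ.1 z = ⨆ i, φ.1.restr (x i) z := fun φ z => by
    simp only [restr_apply]
    rw [← PIso.map_iSup, ← inf_iSup_eq, hs, inf_top_eq]
  intro φ ψ h
  refine Subtype.ext (PIso.ext fun z => ?_)
  rw [key, key]
  refine iSup_congr fun i => ?_
  exact congrArg (fun χ : P.grp (x i) => χ.1 z) (congrFun h i)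

end FullPseudogroup

/-! ### Cardinals that equal their ℵ₀-th power -/

section cardinal

theorem prod_eq_mul_prod_subtype {ι : Type u} (κ : ι → Cardinal.{u}) (p : ι → Prop) :
    prod κ = prod (fun i : {i // p i} => κ i) * prod (fun i : {i // ¬ p i} => κ i) := by
  classical
  have h := mk_congr (Equiv.piEquivPiSubtypeProd p fun i => (κ i).out)
  simpa [mk_pi] using h

theorem prod_power_eq {ι : Type u} (κ : ι → Cardinal.{u}) (c : Cardinal.{u}) :
    prod κ ^ c = prod fun i => κ i ^ c := by
  have h := mk_congr (Equiv.piComm fun (_ : c.out) (i : ι) => (κ i).out)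
  simpa [mk_pi] using h

/-- Factors 1 do not matter. If infinitely many others remain, all finite and at least 2, the
product is 2 to the power of their number. -/
theorem prod_lt_aleph0_or_power_of_lt_aleph0 {ι : Type u} (κ : ι → Cardinal.{u})
    (h0 : ∀ i, κ i ≠ 0) (h : ∀ i, κ i < ℵ₀) : prod κ < ℵ₀ ∨ prod κ ^ ℵ₀ = prod κ := by
  rw [prod_eq_mul_prod_subtype κ fun i => κ i ≠ 1]
  have h1 : prod (fun i : {i // ¬ κ i ≠ 1} => κ i) = 1 := by
    have : (fun i : {i // ¬ κ i ≠ 1} => κ i) = fun _ => 1 := funext fun i => not_not.1 i.2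
    rw [this, prod_const', one_power]
  rw [h1, mul_one]
  rcases finite_or_infinite {i // κ i ≠ 1} with hF | hF
  · left
    have := Fintype.ofFinite {i // κ i ≠ 1}
    rw [prod_eq_of_fintype, lift_id]
    exact Finset.prod_induction _ (· < ℵ₀) (fun _ _ => mul_lt_aleph0) one_lt_aleph0 fun i _ => h i
  · right
    rw [prod_eq_two_power]
    · rw [lift_id, ← power_mul, mul_aleph0_eq (aleph0_le_mk _)]
    · intro i
      have h2 : 1 < κ i := lt_of_le_of_ne (Cardinal.one_le_iff_ne_zero.2 (h0 i)) (Ne.symm i.2)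
      exact two_le_iff_one_lt.2 h2
    · intro i
      simpa using (h i).le.trans (aleph0_le_mk _)

theorem aleph0_le_of_power_eq {κ : Cardinal.{u}} (h2 : 2 ≤ κ) (h : κ ^ ℵ₀ = κ) : ℵ₀ ≤ κ := by
  rw [← h]
  exact (cantor ℵ₀).le.trans (power_le_power_right h2)

/-- The infinite factors multiply to some b with b^ℵ₀ = b. Unless b = 1, it is infinite and absorbs
a finite product of the remaining factors. -/
theorem prod_lt_aleph0_or_power_eq {ι : Type u} (κ : ι → Cardinal.{u}) (h0 : ∀ i, κ i ≠ 0)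
    (h : ∀ i, κ i < ℵ₀ ∨ κ i ^ ℵ₀ = κ i) : prod κ < ℵ₀ ∨ prod κ ^ ℵ₀ = prod κ := by
  rw [prod_eq_mul_prod_subtype κ fun i => κ i < ℵ₀]
  have hb : prod (fun i : {i // ¬ κ i < ℵ₀} => κ i) ^ ℵ₀ =
      prod (fun i : {i // ¬ κ i < ℵ₀} => κ i) := by
    rw [prod_power_eq]; congr 1
    exact funext fun i => (h i).resolve_left i.2
  have hb0 : prod (fun i : {i // ¬ κ i < ℵ₀} => κ i) ≠ 0 := (prod_ne_zero _).2 fun i => h0 i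
  have ha0 : prod (fun i : {i // κ i < ℵ₀} => κ i) ≠ 0 := (prod_ne_zero _).2 fun i => h0 i
  generalize prod (fun i : {i // ¬ κ i < ℵ₀} => κ i) = b at *
  rcases prod_lt_aleph0_or_power_of_lt_aleph0 (fun i : {i // κ i < ℵ₀} => κ i) (fun i => h0 i)
    (fun i => i.2) with ha | ha
  · generalize prod (fun i : {i // κ i < ℵ₀} => κ i) = a at *
    rcases eq_or_ne b 1 with rfl | hb1
    · left; rwa [mul_one]
    · right
      have h2 : 2 ≤ b := by
        have h3 : 1 < b := lt_of_le_of_ne (Cardinal.one_le_iff_ne_zero.2 hb0) (Ne.symm hb1)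
        exact two_le_iff_one_lt.2 h3
      have h3 := aleph0_le_of_power_eq h2 hb
      rw [mul_eq_right h3 (ha.le.trans h3) ha0, hb]
  · right
    rw [mul_power, ha, hb]

theorem power_aleph0_eq_of_le_of_le {κ c s : Cardinal.{u}} (h2 : 2 ≤ κ) (hκ : κ ^ ℵ₀ = κ)
    (hs : s ≠ 0) (h : κ ^ s ≤ c) (h' : c ≤ κ ^ (s * s)) : c ^ ℵ₀ = c := by
  have h3 := aleph0_le_of_power_eq h2 hκ
  have h4 : κ ^ (s * s) = κ ^ s := by
    rcases lt_or_ge s ℵ₀ with hs' | hs'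
    · obtain ⟨n, rfl⟩ := lt_aleph0.1 hs'
      have hn : 1 ≤ n := Nat.one_le_iff_ne_zero.2 (by exact_mod_cast hs)
      rw [power_mul, power_natCast, power_natCast, power_nat_eq h3 hn]
      exact power_nat_eq h3 hn
    · rw [mul_eq_self hs']
  obtain rfl : c = κ ^ s := le_antisymm (h'.trans h4.le) h
  rw [← power_mul, mul_comm, power_mul, hκ]

end cardinal

/-! ### Disjoint families -/

section exhaustion
variable {B : Type u} [CompleteBooleanAlgebra B]

theorem exists_disjoint_family (T : Set B) (e : B) (hT : ∀ t ∈ T, t ≠ ⊥ ∧ t ≤ e)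
    (h : ∀ S ⊆ T, sSup S ≠ e → ∃ t ∈ T, t ≤ e \ sSup S) :
    ∃ S ⊆ T, (∀ x ∈ S, ∀ y ∈ S, x ≠ y → x ⊓ y = ⊥) ∧ sSup S = e := by
  obtain ⟨S, hS⟩ := zorn_subset {S | S ⊆ T ∧ S.Pairwise fun x y => x ⊓ y = ⊥} (by
    intro c hc hchain
    refine ⟨⋃₀ c, ⟨Set.sUnion_subset fun s hs => (hc hs).1, ?_⟩, fun s => Set.subset_sUnion_of_mem⟩
    exact (Set.pairwise_sUnion hchain.directedOn).2 fun s hs => (hc hs).2)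
  refine ⟨S, hS.prop.1, fun x hx y hy => hS.prop.2 hx hy, ?_⟩
  by_contra hne
  obtain ⟨t, ht, hte⟩ := h S hS.prop.1 hne
  have hdis : ∀ y ∈ S, t ⊓ y = ⊥ := fun y hy =>
    (disjoint_sdiff_self_left.mono hte (le_sSup hy)).eq_bot
  have hmem : insert t S ∈ {S | S ⊆ T ∧ S.Pairwise fun x y => x ⊓ y = ⊥} :=
    ⟨Set.insert_subset ht hS.prop.1, hS.prop.2.insert fun y hy _ =>
      ⟨hdis y hy, by rw [inf_comm]; exact hdis y hy⟩⟩
  have h1 : t ∈ S := hS.le_of_ge hmem (Set.subset_insert t S) (Set.mem_insert t S)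
  have h2 := hdis t h1
  rw [inf_idem] at h2
  exact (hT t ht).1 h2

/-- Iterating the choice of z gives a strictly decreasing sequence; its successive differences are
the required elements. -/
theorem exists_disjoint_seq (Z : Set B) {x : B} (hx : x ∈ Z) (hx0 : x ≠ ⊥)
    (h : ∀ y ∈ Z, y ≠ ⊥ → y ≤ x → ∃ z ∈ Z, z ≠ ⊥ ∧ z < y ∧ y \ z ∈ Z) :
    ∃ f : ULift.{u} ℕ → B, (∀ i j, i ≠ j → f i ⊓ f j = ⊥) ∧ ∀ i, f i ∈ Z ∧ f i ≠ ⊥ ∧ f i ≤ x := by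
  choose! z hz hz0 hzlt hzd using h
  let y : ℕ → B := fun n => z^[n] x
  have hy1 : ∀ n, y (n + 1) = z (y n) := fun n => Function.iterate_succ_apply' z n x
  have hy : ∀ n, y n ∈ Z ∧ y n ≠ ⊥ ∧ y n ≤ x := fun n => by
    induction n with
    | zero => exact ⟨hx, hx0, le_rfl⟩
    | succ n ih =>
      rw [hy1]
      exact ⟨hz _ ih.1 ih.2.1 ih.2.2, hz0 _ ih.1 ih.2.1 ih.2.2,
        (hzlt _ ih.1 ih.2.1 ih.2.2).le.trans ih.2.2⟩
  have hlt : ∀ n, y (n + 1) < y n := fun n => by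
    rw [hy1]; exact hzlt _ (hy n).1 (hy n).2.1 (hy n).2.2
  have hanti : Antitone y := antitone_nat_of_succ_le fun n => (hlt n).le
  have hdis : ∀ i j, i < j → (y i \ y (i + 1)) ⊓ (y j \ y (j + 1)) = ⊥ := fun i j hij =>
    (disjoint_sdiff_self_left.mono_right (sdiff_le.trans (hanti hij))).eq_bot
  refine ⟨fun i => y i.down \ y (i.down + 1), ?_, fun i => ⟨?_, ?_, sdiff_le.trans (hy _).2.2⟩⟩
  · rintro ⟨i⟩ ⟨j⟩ hij
    rcases lt_or_gt_of_ne (fun h : i = j => hij (congrArg _ h)) with h | h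
    · exact hdis i j h
    · rw [inf_comm]; exact hdis j i h
  · simp only [hy1]; exact hzd _ (hy _).1 (hy _).2.1 (hy _).2.2
  · rw [Ne, sdiff_eq_bot_iff]
    exact (hlt _).not_ge

end exhaustion

/-! ### The number of automorphisms is finite or its own ℵ₀-th power -/

namespace FullPseudogroup
open PIso
variable {B : Type u} [CompleteBooleanAlgebra B] (P : FullPseudogroup B)

/-- Any two nonzero elements below `e` have equivalent nonzero parts. -/
def ErgodicBelow (e : B) : Prop :=
  ∀ u v : B, u ≠ ⊥ → v ≠ ⊥ → u ≤ e → v ≤ e →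
    ∃ φ ∈ P.carrier, φ.dom ≠ ⊥ ∧ φ.dom ≤ u ∧ φ.ran ≤ v

theorem two_le_mk_hom {x : B} (hx : x ≠ ⊥) : 2 ≤ #(P.hom x x) := by
  refine two_le_iff.2 ⟨⟨idOn ⊥, P.idOn_mem _, by simp, by simp⟩,
    ⟨idOn x, P.idOn_mem _, by simp, by simp⟩, fun h => hx ?_⟩
  have h1 := congrArg dom (congrArg Subtype.val h)
  simpa using h1.symm

theorem mk_hom_atom_le {a : B} (ha : IsAtom a) : #(P.hom a a) ≤ 2 := by
  have key : ∀ (φ ψ : P.hom a a), (φ.1.dom = ⊥ ↔ ψ.1.dom = ⊥) → φ = ψ := by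
    intro φ ψ h
    refine Subtype.ext (PIso.ext fun z => ?_)
    by_cases h0 : φ.1.dom = ⊥
    · rw [← φ.1.apply_inf_dom, ← ψ.1.apply_inf_dom, h0, h.1 h0]; simp
    · have hdom : ∀ χ : P.hom a a, χ.1.dom ≠ ⊥ → χ.1.dom = a ∧ χ.1 a = a := fun χ hχ => by
        have h1 := (ha.le_iff.1 χ.2.2.1).resolve_left hχ
        refine ⟨h1, ?_⟩
        have h2 : χ.1 a ≤ a := (apply_le_ran _ _).trans χ.2.2.2
        exact (ha.le_iff.1 h2).resolve_left (χ.1.apply_ne_bot h1.ge ha.1)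
      have hφ := hdom φ h0
      have hψ := hdom ψ fun h' => h0 (h.2 h')
      rw [← φ.1.apply_inf_dom, ← ψ.1.apply_inf_dom, hφ.1, hψ.1]
      rcases ha.le_iff.1 (inf_le_right : z ⊓ a ≤ a) with h1 | h1
      · rw [h1]; simp
      · rw [h1, hφ.2, hψ.2]
  have := mk_le_of_injective (f := fun φ : P.hom a a => (⟨φ.1.dom = ⊥⟩ : ULift.{u} Prop))
    fun φ ψ h => key φ ψ (iff_of_eq (congrArg ULift.down h))
  simpa using this

variable {P}

/-- Take a maximal disjoint family of elements that embed in x. By ergodicity, any nonzero remainder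
would contain another one. -/
theorem ErgodicBelow.exists_cover {e x : B} (h : P.ErgodicBelow e) (hx : x ≠ ⊥) (hxe : x ≤ e) :
    ∃ S : Set B, (∀ s ∈ S, s ≠ ⊥ ∧ s ≤ e ∧ ∃ θ ∈ P.carrier, θ.dom = s ∧ θ.ran ≤ x) ∧
      (∀ s t : S, s ≠ t → s.1 ⊓ t.1 = ⊥) ∧ ⨆ s : S, s.1 = e := by
  obtain ⟨S, hS, hd, hs⟩ := exists_disjoint_family
    {s | s ≠ ⊥ ∧ s ≤ e ∧ ∃ θ ∈ P.carrier, θ.dom = s ∧ θ.ran ≤ x} e (fun t ht => ⟨ht.1, ht.2.1⟩) (by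
      intro S hS hne
      have h1 : sSup S ≤ e := sSup_le fun s hs => (hS hs).2.1
      have h2 : e \ sSup S ≠ ⊥ := fun h2 => hne (le_antisymm h1 (sdiff_eq_bot_iff.1 h2))
      obtain ⟨φ, hφ, h3, h4, h5⟩ := h _ x h2 hx sdiff_le hxe
      exact ⟨φ.dom, ⟨h3, h4.trans sdiff_le, φ, hφ, rfl, h5⟩, h4⟩)
  refine ⟨S, fun s hs => hS hs, fun s t hst => hd s s.2 t t.2 fun h => hst (Subtype.ext h), ?_⟩
  rw [← sSup_eq_iSup', hs]

theorem ErgodicBelow.mk_grp_le {e x : B} {S : Set B}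
    (hS : ∀ s ∈ S, s ≠ ⊥ ∧ s ≤ e ∧ ∃ θ ∈ P.carrier, θ.dom = s ∧ θ.ran ≤ x)
    (hs : ⨆ s : S, s.1 = e) : #(P.grp e) ≤ #(P.hom x x) ^ (#S * #S) := by
  have h1 := P.mk_grp_le_prod fun s : S => s.1
  rw [hs] at h1
  refine h1.trans ?_
  have h2 : #S * #S = #(S × S) := by simp
  rw [h2, ← prod_const']
  refine prod_le_prod _ _ fun p => ?_
  obtain ⟨_, _, θ, hθ, hd, hr⟩ := hS _ p.1.2
  obtain ⟨_, _, η, hη, hd', hr'⟩ := hS _ p.2.2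
  exact P.mk_hom_le_of_equiv hθ hη hd hr hd' hr'

theorem ErgodicBelow.exists_hom_le_grp {e y u v : B} (h : P.ErgodicBelow e) (hy : y ≤ e)
    (hu : u ≠ ⊥) (hv : v ≠ ⊥) (huy : u ≤ y) (hvy : v ≤ y) (huv : u ⊓ v = ⊥) :
    ∃ w ≤ e, w ≠ ⊥ ∧ #(P.hom w w) ≤ #(P.grp y) := by
  obtain ⟨ρ, hρ, h1, h2, h3⟩ := h u v hu hv (huy.trans hy) (hvy.trans hy)
  refine ⟨ρ.dom, h2.trans (huy.trans hy), h1, P.mk_hom_le_grp (h2.trans huy) (h3.trans hvy)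
    (le_bot_iff.1 ((inf_le_inf h2 h3).trans huv.le)) hρ rfl rfl⟩

theorem exists_homogeneous (f : B → Cardinal.{u}) (Z : Set B) {e : B} (he : e ∈ Z) (he0 : e ≠ ⊥) :
    ∃ x ∈ Z, x ≠ ⊥ ∧ x ≤ e ∧ ∀ y ∈ Z, y ≠ ⊥ → y ≤ e → f x ≤ f y := by
  obtain ⟨x, hx, hmin⟩ := WellFounded.has_min (InvImage.wf f Cardinal.lt_wf)
    {x | x ∈ Z ∧ x ≠ ⊥ ∧ x ≤ e} ⟨e, he, he0, le_rfl⟩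
  exact ⟨x, hx.1, hx.2.1, hx.2.2, fun y h1 h2 h3 => not_lt.1 (hmin y ⟨h1, h2, h3⟩)⟩

/-- Choose x with κ = `#(P.hom x x)` least. Infinitely many disjoint parts of x give κ^ℵ₀ ≤ κ. Cover
e by s pieces that embed in x: matrices give `#(P.grp e)` ≤ κ^(s·s). Each piece splits in two and so
has at least κ automorphisms, by minimality, whence κ^s ≤ `#(P.grp e)`. -/
theorem ErgodicBelow.power_eq_of_atomless {e : B} (h : P.ErgodicBelow e) (he : e ≠ ⊥)
    (hat : ∀ y ≤ e, y ≠ ⊥ → ∃ z < y, z ≠ ⊥) : #(P.grp e) ^ ℵ₀ = #(P.grp e) := by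
  obtain ⟨x, -, hx, hxe, hmin⟩ := exists_homogeneous (fun x => #(P.hom x x)) Set.univ trivial he
  have hκ : #(P.hom x x) ^ ℵ₀ = #(P.hom x x) := by
    obtain ⟨f, hd, hf⟩ := exists_disjoint_seq Set.univ trivial hx fun y _ hy hyx => by
      obtain ⟨z, hz, hz0⟩ := hat y (hyx.trans hxe) hy
      exact ⟨z, trivial, hz0, hz, trivial⟩
    refine le_antisymm ?_ (self_le_power _ one_le_aleph0)
    have h1 : (ℵ₀ : Cardinal.{u}) = #(ULift.{u} ℕ) := by simp
    rw [h1, ← prod_const']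
    exact (prod_le_prod _ _ fun i => hmin _ trivial (hf i).2.1 ((hf i).2.2.trans hxe)).trans
      (P.prod_mk_hom_le f hd fun i => (hf i).2.2)
  obtain ⟨S, hS, hd, hs⟩ := h.exists_cover hx hxe
  refine power_aleph0_eq_of_le_of_le (P.two_le_mk_hom hx) hκ (s := #S) ?_ ?_ (mk_grp_le hS hs)
  · intro h0
    have := mk_eq_zero_iff.1 h0
    exact he (by rw [← hs, iSup_of_empty])
  · have h1 := P.prod_mk_grp_le (fun s : S => s.1) hd
    rw [hs] at h1
    rw [← prod_const']
    refine le_trans (prod_le_prod _ _ fun s => ?_) h1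
    obtain ⟨hs0, hse, -⟩ := hS _ s.2
    obtain ⟨z, hz, hz0⟩ := hat _ hse hs0
    obtain ⟨w, hw, hw0, hle⟩ := h.exists_hom_le_grp hse hz0
      (v := s.1 \ z) (fun h' => hz.not_ge (sdiff_eq_bot_iff.1 h')) hz.le sdiff_le
      inf_sdiff_self_right
    exact (hmin w trivial hw0 hw).trans hle

/-- The pieces of the cover embed in the atom, so a matrix entry has at most two values. With
infinitely many pieces, grouping them in pairs gives as many independent choices between at least
two automorphisms, and `#(P.grp e)` is 2 to the number of pieces. -/
theorem ErgodicBelow.power_eq_of_atom {e a : B} (h : P.ErgodicBelow e) (ha : IsAtom a)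
    (hae : a ≤ e) : #(P.grp e) < ℵ₀ ∨ #(P.grp e) ^ ℵ₀ = #(P.grp e) := by
  obtain ⟨S, hS, hd, hs⟩ := h.exists_cover ha.1 hae
  have h1 : #(P.grp e) ≤ 2 ^ (#S * #S) :=
    (mk_grp_le hS hs).trans (power_le_power_right (P.mk_hom_atom_le ha))
  rcases lt_or_ge #S ℵ₀ with hfin | hinf
  · left
    exact h1.trans_lt (power_lt_aleph0 ofNat_lt_aleph0 (mul_lt_aleph0 hfin hfin))
  · right
    rw [mul_eq_self hinf] at h1
    have h2 : #(P.grp e) = 2 ^ #S := by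
      refine le_antisymm h1 ?_
      have h3 : #(S ⊕ S) = #S := by rw [mk_sum, lift_id, add_eq_self hinf]
      obtain ⟨E⟩ := Cardinal.eq.1 h3
      have hne : ∀ p q : S ⊕ S, p ≠ q → (E p).1 ⊓ (E q).1 = ⊥ := fun p q hpq =>
        hd _ _ (E.injective.ne hpq)
      have hE : ∀ p, (E p).1 ≠ ⊥ ∧ (E p).1 ≤ e := fun p =>
        ⟨(hS _ (E p).2).1, (hS _ (E p).2).2.1⟩
      let y : S → B := fun s => (E (Sum.inl s)).1 ⊔ (E (Sum.inr s)).1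
      have hye : ∀ s, y s ≤ e := fun s => sup_le (hE _).2 (hE _).2
      have hy : ∀ s t, s ≠ t → y s ⊓ y t = ⊥ := by
        intro s t hst
        simp only [y, inf_sup_left, inf_sup_right]
        simp [hne, hst]
      rw [← prod_const']
      refine ((prod_le_prod _ _ fun s => ?_).trans (P.prod_mk_grp_le y hy)).trans
        (P.mk_grp_mono (iSup_le hye))
      obtain ⟨w, hw, hw0, hle⟩ := h.exists_hom_le_grp (hye s) (hE (Sum.inl s)).1
        (hE (Sum.inr s)).1 le_sup_left le_sup_right (hne _ _ (by simp))
      exact (P.two_le_mk_hom hw0).trans hle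
    rw [h2, ← power_mul, mul_aleph0_eq hinf]

theorem ErgodicBelow.lt_aleph0_or_power_eq {e : B} (h : P.ErgodicBelow e) (he : e ≠ ⊥) :
    #(P.grp e) < ℵ₀ ∨ #(P.grp e) ^ ℵ₀ = #(P.grp e) := by
  by_cases hat : ∃ a ≤ e, IsAtom a
  · obtain ⟨a, hae, ha⟩ := hat
    exact h.power_eq_of_atom ha hae
  · refine Or.inr (h.power_eq_of_atomless he fun y hy hy0 => ?_)
    by_contra! hc
    exact hat ⟨y, hy, hy0, hc⟩

/-- The join of all images of u is central, so by minimality it covers e; hence some image of u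
meets v. -/
theorem ergodicBelow_of_minimal {e : B} (he : e ∈ P.central)
    (hmin : ∀ f ∈ P.central, f ≠ ⊥ → f ≤ e → ¬ f < e) : P.ErgodicBelow e := by
  intro u v hu hv hue hve
  have h1 : (⨆ φ : P.carrier, φ.1 u) ⊓ e = e := by
    by_contra hne
    refine hmin _ (central_inf (P.hull_mem_central u) he) (fun h0 => hu ?_) inf_le_right
      (lt_of_le_of_ne inf_le_right hne)
    exact le_bot_iff.1 ((le_inf (P.le_hull u) hue).trans h0.le)
  have h2 : ∃ φ : P.carrier, φ.1 u ⊓ v ≠ ⊥ := by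
    by_contra! hc
    apply hv
    have h3 : v ≤ (⨆ φ : P.carrier, φ.1 u) := hve.trans (inf_eq_right.1 h1)
    rw [← inf_eq_right.2 h3, iSup_inf_eq]
    simp [hc]
  obtain ⟨φ, hφ⟩ := h2
  have hr : ((φ.1.restr u).trans (idOn v)).ran = φ.1 u ⊓ v := by
    rw [trans_ran, restr_ran, idOn_apply]
  refine ⟨(φ.1.restr u).trans (idOn v), P.trans_mem (P.restr_mem φ.2 _) (P.idOn_mem _), ?_, ?_, ?_⟩
  · intro h0
    apply hφ
    rw [← hr, ← apply_dom, h0, PIso.map_bot]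
  · rw [trans_dom]
    exact (symm_apply_le_dom _ _).trans inf_le_right
  · rw [hr]; exact inf_le_right

/-- Take x central with the least group. If no minimal central element lies below x, there are
infinitely many disjoint central ones, each with a group at least as large, so `#(P.grp x)` ^ ℵ₀ ≤
`#(P.grp x)`. Otherwise a minimal one is ergodic. -/
theorem exists_central_good {e : B} (he : e ∈ P.central) (he0 : e ≠ ⊥) :
    ∃ f ∈ P.central, f ≠ ⊥ ∧ f ≤ e ∧ (#(P.grp f) < ℵ₀ ∨ #(P.grp f) ^ ℵ₀ = #(P.grp f)) := by
  obtain ⟨x, hxc, hx0, hxe, hmin⟩ := exists_homogeneous (fun x => #(P.grp x)) P.central he he0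
  by_cases hc : ∃ f ∈ P.central, f ≠ ⊥ ∧ f ≤ x ∧ ∀ g ∈ P.central, g ≠ ⊥ → g ≤ f → ¬ g < f
  · obtain ⟨f, hf, hf0, hfx, hfm⟩ := hc
    exact ⟨f, hf, hf0, hfx.trans hxe, (ergodicBelow_of_minimal hf hfm).lt_aleph0_or_power_eq hf0⟩
  · push Not at hc
    obtain ⟨f, hd, hf⟩ := exists_disjoint_seq P.central hxc hx0 fun y hy hy0 hyx => by
      obtain ⟨z, hz, hz0, -, hzy⟩ := hc y hy hy0 hyx
      exact ⟨z, hz, hz0, hzy, central_sdiff hy hz⟩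
    refine ⟨x, hxc, hx0, hxe, Or.inr (le_antisymm ?_ (self_le_power _ one_le_aleph0))⟩
    have h1 : (ℵ₀ : Cardinal.{u}) = #(ULift.{u} ℕ) := by simp
    rw [h1, ← prod_const']
    exact ((prod_le_prod _ _ fun i => hmin _ (hf i).1 (hf i).2.1 ((hf i).2.2.trans hxe)).trans
      (P.prod_mk_grp_le f hd)).trans (P.mk_grp_mono (iSup_le fun i => (hf i).2.2))

variable (P)

theorem mk_grp_top_lt_aleph0_or_power_eq :
    #(P.grp ⊤) < ℵ₀ ∨ #(P.grp ⊤) ^ ℵ₀ = #(P.grp ⊤) := by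
  obtain ⟨S, hS, hd, hs⟩ := exists_disjoint_family
    {f | f ∈ P.central ∧ f ≠ ⊥ ∧ (#(P.grp f) < ℵ₀ ∨ #(P.grp f) ^ ℵ₀ = #(P.grp f))} ⊤
    (fun t ht => ⟨ht.2.1, le_top⟩) (by
      intro S hS hne
      have h1 : ⊤ \ sSup S ∈ P.central :=
        central_sdiff P.top_mem_central (P.sSup_mem_central fun s hs => (hS hs).1)
      obtain ⟨f, h2, h3, h4, h5⟩ := exists_central_good h1 fun h =>
        hne (top_le_iff.1 (sdiff_eq_bot_iff.1 h))
      exact ⟨f, ⟨h2, h3, h5⟩, h4⟩)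
  rw [sSup_eq_iSup'] at hs
  have h1 : #(P.grp ⊤) = prod fun s : S => #(P.grp s.1) := by
    refine le_antisymm (P.mk_grp_top_le_prod _ (fun s => (hS s.2).1) hs) ?_
    rw [← hs]
    exact P.prod_mk_grp_le _ fun s t hst => hd s s.2 t t.2 fun h => hst (Subtype.ext h)
  rw [h1]
  exact prod_lt_aleph0_or_power_eq _
    (fun s => Cardinal.one_le_iff_ne_zero.1 (P.mk_grp_pos s.1)) fun s => (hS s.2).2.2

end FullPseudogroup

/-! ### The completion of `A` -/

section perp
variable {A : Type u} [BooleanAlgebra A]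

/-- The elements disjoint from all elements of `U`. -/
def perp (U : Set A) : Set A := {x | ∀ u ∈ U, x ⊓ u = ⊥}

theorem perp_anti {U V : Set A} (h : U ⊆ V) : perp V ⊆ perp U := fun _ hx u hu => hx u (h hu)

theorem subset_perp_perp (U : Set A) : U ⊆ perp (perp U) := fun x hx u hu => by
  rw [inf_comm]; exact hu x hx

theorem perp_perp_perp (U : Set A) : perp (perp (perp U)) = perp U :=
  (perp_anti (subset_perp_perp U)).antisymm (subset_perp_perp _)

theorem perp_lower {U : Set A} {x y : A} (hy : y ∈ perp U) (h : x ≤ y) : x ∈ perp U :=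
  fun u hu => le_bot_iff.1 ((inf_le_inf_right u h).trans (hy u hu).le)

theorem perp_sup {U : Set A} {x y : A} (hx : x ∈ perp U) (hy : y ∈ perp U) : x ⊔ y ∈ perp U :=
  fun u hu => by rw [inf_sup_right, hx u hu, hy u hu, sup_bot_eq]

theorem bot_mem_perp (U : Set A) : ⊥ ∈ perp U := fun _ _ => bot_inf_eq _

variable (A) in
/-- The completion of `A`: the sets `U` with `U ^ ⊥⊥ = U`. -/
@[ext] structure Completion where
  carrier : Set A
  perp_perp : perp (perp carrier) = carrier

namespace Completion

/-- The element of the completion generated by a set. -/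
def cl (U : Set A) : Completion A := ⟨perp (perp U), perp_perp_perp _⟩

instance : PartialOrder (Completion A) where
  le x y := x.carrier ⊆ y.carrier
  le_refl _ := Set.Subset.rfl
  le_trans _ _ _ := Set.Subset.trans
  le_antisymm _ _ h h' := Completion.ext (h.antisymm h')

theorem le_def {x y : Completion A} : x ≤ y ↔ x.carrier ⊆ y.carrier := Iff.rfl

theorem cl_le {U : Set A} {y : Completion A} : cl U ≤ y ↔ U ⊆ y.carrier := by
  refine ⟨(subset_perp_perp U).trans, fun h => ?_⟩
  rw [le_def, ← y.perp_perp]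
  exact perp_anti (perp_anti h)

theorem mem_lower {x : Completion A} {a b : A} (hb : b ∈ x.carrier) (h : a ≤ b) :
    a ∈ x.carrier := by
  rw [← x.perp_perp] at hb ⊢; exact perp_lower hb h

theorem mem_sup {x : Completion A} {a b : A} (ha : a ∈ x.carrier) (hb : b ∈ x.carrier) :
    a ⊔ b ∈ x.carrier := by
  rw [← x.perp_perp] at ha hb ⊢; exact perp_sup ha hb

theorem bot_mem (x : Completion A) : ⊥ ∈ x.carrier := by
  rw [← x.perp_perp]; exact bot_mem_perp _

theorem perp_perp_inter (x y : Completion A) :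
    perp (perp (x.carrier ∩ y.carrier)) = x.carrier ∩ y.carrier := by
  refine Set.Subset.antisymm (Set.subset_inter ?_ ?_) (subset_perp_perp _)
  · conv_rhs => rw [← x.perp_perp]
    exact perp_anti (perp_anti Set.inter_subset_left)
  · conv_rhs => rw [← y.perp_perp]
    exact perp_anti (perp_anti Set.inter_subset_right)

instance : Lattice (Completion A) where
  sup x y := cl (x.carrier ∪ y.carrier)
  inf x y := ⟨x.carrier ∩ y.carrier, perp_perp_inter x y⟩
  le_sup_left _ _ := Set.subset_union_left.trans (subset_perp_perp _)
  le_sup_right _ _ := Set.subset_union_right.trans (subset_perp_perp _)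
  sup_le _ _ _ h h' := cl_le.2 (Set.union_subset h h')
  inf_le_left _ _ := Set.inter_subset_left
  inf_le_right _ _ := Set.inter_subset_right
  le_inf _ _ _ h h' := Set.subset_inter h h'

instance : BoundedOrder (Completion A) where
  top := ⟨Set.univ, (Set.subset_univ _).antisymm (subset_perp_perp _)⟩
  le_top x := Set.subset_univ x.carrier
  bot := cl ∅
  bot_le _ := cl_le.2 (Set.empty_subset _)

theorem mem_bot {a : A} : a ∈ (⊥ : Completion A).carrier ↔ a = ⊥ := by
  refine ⟨fun h => ?_, fun h => h ▸ bot_mem _⟩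
  have : a ⊓ a = ⊥ := h a fun _ hu => hu.elim
  rwa [inf_idem] at this

instance : BooleanAlgebra (Completion A) where
  __ := (inferInstance : Lattice (Completion A))
  __ := (inferInstance : BoundedOrder (Completion A))
  compl x := ⟨perp x.carrier, perp_perp_perp _⟩
  le_sup_inf x y z := by
    have key : ∀ x y z : Completion A, x ⊓ (y ⊔ z) ≤ x ⊓ y ⊔ x ⊓ z := by
      rintro x y z w ⟨hwx, hw⟩ t ht
      have h1 : t ⊓ w ∈ perp (y.carrier ∪ z.carrier) := by
        rintro u (hu | hu)
        · rw [inf_assoc]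
          exact ht _ (Or.inl ⟨mem_lower hwx inf_le_left, mem_lower hu inf_le_right⟩)
        · rw [inf_assoc]
          exact ht _ (Or.inr ⟨mem_lower hwx inf_le_left, mem_lower hu inf_le_right⟩)
      have h2 := hw _ h1
      rwa [inf_comm t, ← inf_assoc, inf_idem] at h2
    exact (DistribLattice.ofInfSupLe key).le_sup_inf x y z
  inf_compl_le_bot x := by
    rintro w ⟨hw, hw'⟩
    rw [mem_bot]
    have := hw' w hw
    rwa [inf_idem] at this
  top_le_sup_compl x := by
    rintro w - t ht
    have h1 : t ∈ perp x.carrier := perp_anti Set.subset_union_left ht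
    have h2 := ht t (Or.inr h1)
    rw [inf_idem] at h2
    rw [h2, inf_bot_eq]

noncomputable instance : CompleteBooleanAlgebra (Completion A) where
  __ := (inferInstance : BooleanAlgebra (Completion A))
  sSup S := cl (⋃ x ∈ S, x.carrier)
  sInf S := ⟨⋂ x ∈ S, x.carrier, by
    refine (Set.subset_iInter₂ fun x hx => ?_).antisymm (subset_perp_perp _)
    conv_rhs => rw [← x.perp_perp]
    exact perp_anti (perp_anti (Set.biInter_subset_of_mem hx))⟩
  isLUB_sSup S := ⟨fun x hx => (Set.subset_biUnion_of_mem (u := fun x : Completion A => x.carrier)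
    hx).trans (subset_perp_perp _), fun y hy => cl_le.2 (Set.iUnion₂_subset fun x hx => hy hx)⟩
  isGLB_sInf S := ⟨fun x hx => Set.biInter_subset_of_mem (t := fun x : Completion A => x.carrier) hx,
    fun y hy => Set.subset_iInter₂ fun x hx => hy hx⟩

/-- The embedding of `A` in its completion. -/
def of (a : A) : Completion A := ⟨Set.Iic a, by
  refine Set.Subset.antisymm (fun x hx => ?_) (subset_perp_perp _)
  have h : aᶜ ∈ perp (Set.Iic a) := fun u hu =>
    (disjoint_compl_left.mono_right hu).eq_bot
  have h2 := hx _ h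
  rwa [← disjoint_iff, disjoint_compl_right_iff] at h2⟩

theorem of_le {a : A} {x : Completion A} : of a ≤ x ↔ a ∈ x.carrier :=
  ⟨fun h => h (le_refl a), fun h _ hb => mem_lower h hb⟩

@[simp] theorem of_le_of {a b : A} : of a ≤ of b ↔ a ≤ b := of_le

theorem of_injective : Function.Injective (of : A → Completion A) := fun _ _ h =>
  le_antisymm (of_le_of.1 h.le) (of_le_of.1 h.ge)

theorem of_inf (a b : A) : of (a ⊓ b) = of a ⊓ of b :=
  Completion.ext (Set.ext fun _ => le_inf_iff)

@[simp] theorem of_bot : of (⊥ : A) = ⊥ := Completion.ext (Set.ext fun x => by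
  rw [mem_bot]; exact le_bot_iff)

theorem of_eq_bot {a : A} : of a = ⊥ ↔ a = ⊥ := by rw [← of_bot, of_injective.eq_iff]

theorem of_sup (a b : A) : of (a ⊔ b) = of a ⊔ of b :=
  le_antisymm (of_le.2 (mem_sup (of_le.1 le_sup_left) (of_le.1 le_sup_right)))
    (sup_le (of_le_of.2 le_sup_left) (of_le_of.2 le_sup_right))

theorem exists_of_le {x : Completion A} (hx : x ≠ ⊥) : ∃ a : A, a ≠ ⊥ ∧ of a ≤ x := by
  by_contra! h
  refine hx (le_bot_iff.1 fun a ha => ?_)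
  rw [mem_bot]
  by_contra h0
  exact h a h0 (of_le.2 ha)

/-- A set of elements of `A` that is dense below `x` has supremum above `x`. -/
theorem le_of_dense {x y : Completion A}
    (h : ∀ a : A, a ≠ ⊥ → of a ≤ x → ∃ b ≤ a, b ≠ ⊥ ∧ of b ≤ y) : x ≤ y := by
  by_contra hxy
  obtain ⟨a, ha, hax⟩ := exists_of_le fun h0 => hxy (sdiff_eq_bot_iff.1 h0)
  obtain ⟨b, hba, hb, hby⟩ := h a ha (hax.trans sdiff_le)
  refine hb (of_eq_bot.1 (le_bot_iff.1 ?_))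
  rw [← inf_sdiff_self_right (x := y) (y := x)]
  exact le_inf hby ((of_le_of.2 hba).trans hax)

theorem exists_disjoint_of_not_le {a : A} {x : Completion A} (h : ¬ of a ≤ x) :
    ∃ b ≤ a, b ≠ ⊥ ∧ of b ⊓ x = ⊥ := by
  obtain ⟨b, hb, hba⟩ := exists_of_le fun h0 => h (sdiff_eq_bot_iff.1 h0)
  exact ⟨b, of_le_of.1 (hba.trans sdiff_le), hb, (disjoint_sdiff_self_left.mono_left hba).eq_bot⟩

end Completion

theorem closureSet_eq_perp_perp (I : Order.Ideal A) : closureSet I = perp (perp (I : Set A)) := by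
  ext x
  constructor
  · intro h t ht
    by_contra h0
    obtain ⟨z, hz, hz0, hzx⟩ := h _ inf_le_left h0
    apply hz0
    have h1 := ht z hz
    rwa [inf_eq_right.2 (hzx.trans inf_le_right)] at h1
  · intro h y hy hy0
    by_contra! hc
    have h1 : y ∈ perp (I : Set A) := fun u hu => by
      by_contra h0
      exact hc _ (I.lower inf_le_right hu) h0 inf_le_left
    have h2 := h y h1
    rw [inf_eq_right.2 hy] at h2
    exact hy0 h2

/-- The ideal of `A` given by an element of the completion. -/
def Completion.toIdeal (x : Completion A) : Order.Ideal A where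
  carrier := x.carrier
  lower' _ _ h hb := Completion.mem_lower hb h
  nonempty' := ⟨⊥, x.bot_mem⟩
  directed' a ha b hb := ⟨a ⊔ b, Completion.mem_sup ha hb, le_sup_left, le_sup_right⟩

theorem mk_completion_eq_idc : #(Completion A) = idc A := by
  refine le_antisymm ?_ ?_
  · refine mk_le_of_injective (f := fun x : Completion A => (⟨x.toIdeal, by
      change closureSet x.toIdeal = _
      rw [closureSet_eq_perp_perp]; exact x.perp_perp⟩ : Idc A)) fun x y h => ?_
    exact Completion.ext (congrArg (fun I : Idc A => (I.1 : Set A)) h)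
  · refine mk_le_of_injective (f := fun I : Idc A => (⟨(I.1 : Set A), by
      rw [← closureSet_eq_perp_perp]; exact I.2⟩ : Completion A)) fun I J h => ?_
    exact Subtype.ext (SetLike.coe_injective (congrArg Completion.carrier h))

theorem aleph0_le_idc [Infinite A] : ℵ₀ ≤ idc A := by
  rw [← mk_completion_eq_idc]
  exact (aleph0_le_mk A).trans (mk_le_of_injective Completion.of_injective)

end perp

/-! ### The pseudogroup that `A` induces on its completion -/

variable {A : Type u} [BooleanAlgebra A]
open Completion PIso

/-- `φ` restricts to an isomorphism between the parts of `A` below `a` and below `φ a`. -/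
def Good (φ : PIso (Completion A)) (a : A) : Prop :=
  of a ≤ φ.dom ∧ (∀ b ≤ a, ∃ c, φ (of b) = of c) ∧
    ∀ c, of c ≤ φ (of a) → ∃ b, φ.symm (of c) = of b

namespace Good
variable {φ : PIso (Completion A)} {a b : A}

theorem lower (h : Good φ a) (hb : b ≤ a) : Good φ b :=
  ⟨(of_le_of.2 hb).trans h.1, fun c hc => h.2.1 c (hc.trans hb),
    fun c hc => h.2.2 c (hc.trans (φ.mono (of_le_of.2 hb)))⟩

theorem sup (ha : Good φ a) (hb : Good φ b) : Good φ (a ⊔ b) := by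
  refine ⟨of_sup a b ▸ sup_le ha.1 hb.1, fun c hc => ?_, fun c hc => ?_⟩
  · obtain ⟨c₁, h₁⟩ := ha.2.1 (c ⊓ a) inf_le_right
    obtain ⟨c₂, h₂⟩ := hb.2.1 (c ⊓ b) inf_le_right
    refine ⟨c₁ ⊔ c₂, ?_⟩
    rw [← inf_eq_left.2 hc, inf_sup_left, of_sup, PIso.map_sup, h₁, h₂, of_sup]
  · obtain ⟨a', ha'⟩ := ha.2.1 a le_rfl
    obtain ⟨b', hb'⟩ := hb.2.1 b le_rfl
    rw [of_sup, PIso.map_sup, ha', hb', ← of_sup, of_le_of] at hc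
    obtain ⟨c₁, h₁⟩ := ha.2.2 (c ⊓ a') (ha' ▸ of_le_of.2 inf_le_right)
    obtain ⟨c₂, h₂⟩ := hb.2.2 (c ⊓ b') (hb' ▸ of_le_of.2 inf_le_right)
    refine ⟨c₁ ⊔ c₂, ?_⟩
    rw [← inf_eq_left.2 hc, inf_sup_left, of_sup, PIso.map_sup, h₁, h₂, of_sup]

theorem bot : Good φ ⊥ := by
  refine ⟨by simp, fun b hb => ⟨⊥, ?_⟩, fun c hc => ⟨⊥, ?_⟩⟩
  · rw [le_bot_iff.1 hb]; simp
  · rw [of_bot, PIso.map_bot, le_bot_iff] at hc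
    rw [hc]; simp

theorem symm (h : Good φ a) (hb : φ (of a) = of b) : Good φ.symm b := by
  refine ⟨hb ▸ φ.apply_le_ran _, fun c hc => h.2.2 c (hb ▸ of_le_of.2 hc), fun c hc => ?_⟩
  rw [← hb, symm_apply_apply_of_le _ h.1, of_le_of] at hc
  exact h.2.1 c hc

end Good

variable (A) in
/-- The partial isomorphisms of the completion that are isomorphisms of ideals of `A` on a dense
part of their domain. -/
def localPseudogroup : FullPseudogroup (Completion A) where
  carrier := {φ | ∀ y ≤ φ.dom, y ≠ ⊥ → ∃ a, a ≠ ⊥ ∧ of a ≤ y ∧ Good φ a}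
  idOn_mem b := by
    intro y hy hy0
    obtain ⟨a, ha, hay⟩ := exists_of_le hy0
    have hab : of a ≤ b := by simpa using hay.trans hy
    have hfix : ∀ c ≤ a, of c ⊓ b = of c := fun c hc => inf_eq_left.2 ((of_le_of.2 hc).trans hab)
    refine ⟨a, ha, hay, hay.trans hy, fun c hc => ⟨c, hfix c hc⟩, fun c hc => ⟨c, hfix c ?_⟩⟩
    rw [idOn_apply, hfix a le_rfl, of_le_of] at hc
    exact hc
  symm_mem := by
    intro φ hφ y hy hy0
    obtain ⟨a, ha, hay, hg⟩ := hφ _ (φ.symm_apply_le_dom y) (φ.symm.apply_ne_bot hy hy0)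
    obtain ⟨c, hc⟩ := hg.2.1 a le_rfl
    refine ⟨c, fun h0 => ?_, ?_, hg.symm hc⟩
    · refine φ.apply_ne_bot hg.1 (fun h => ha (of_eq_bot.1 h)) ?_
      rw [hc, h0, of_bot]
    · rw [← hc, ← φ.apply_symm_apply_of_le hy]
      exact φ.mono hay
  trans_mem := by
    intro φ ψ hφ hψ y hy hy0
    have hyd : y ≤ φ.dom := hy.trans (φ.symm_apply_le_dom _)
    obtain ⟨a, ha, hay, hga⟩ := hφ y hyd hy0
    obtain ⟨c, hc⟩ := hga.2.1 a le_rfl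
    have hcd : of c ≤ ψ.dom := by
      rw [← hc]
      exact (φ.mono (hay.trans hy)).trans ((φ.apply_symm_apply _).trans_le inf_le_left)
    have hc0 : of c ≠ ⊥ := hc ▸ φ.apply_ne_bot hga.1 fun h => ha (of_eq_bot.1 h)
    -- Goodness passes to smaller elements: shrink the image of a to some d good for ψ, and pull d
    -- back to b.
    obtain ⟨d, hd, hdc, hgd⟩ := hψ _ hcd hc0
    obtain ⟨b, hb⟩ := hga.2.2 d (hc ▸ hdc)
    have hdr : of d ≤ φ.ran := hdc.trans (hc ▸ φ.apply_le_ran _)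
    have hb' : φ (of b) = of d := by rw [← hb, φ.apply_symm_apply_of_le hdr]
    have hba : b ≤ a := by
      rw [← of_le_of, ← hb, ← φ.symm_apply_apply_of_le hga.1, hc]
      exact φ.symm.mono hdc
    refine ⟨b, fun h0 => hd (of_eq_bot.1 ?_), (of_le_of.2 hba).trans hay, ?_, fun b₁ h₁ => ?_,
      fun e he => ?_⟩
    · rw [← hb', h0, of_bot, PIso.map_bot]
    · rw [← hb]; exact φ.symm.mono hgd.1
    · obtain ⟨d₁, hd₁⟩ := hga.2.1 b₁ (h₁.trans hba)
      rw [trans_apply, hd₁]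
      refine hgd.2.1 d₁ (of_le_of.1 ?_)
      rw [← hd₁, ← hb']
      exact φ.mono (of_le_of.2 h₁)
    · rw [trans_apply, hb'] at he
      obtain ⟨d₁, hd₁⟩ := hgd.2.2 e he
      rw [trans_symm, trans_apply, hd₁]
      refine hga.2.2 d₁ ?_
      rw [hc, ← hd₁]
      refine (ψ.symm.mono he).trans ?_
      rw [ψ.symm_apply_apply_of_le hgd.1]; exact hdc
  of_local := by
    intro φ h y hy hy0
    obtain ⟨x, hxy, hx0, hx⟩ := h y hy hy0
    obtain ⟨a, ha, hax, hg⟩ := hx x (le_inf (hxy.trans hy) le_rfl) hx0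
    have hfix : ∀ b ≤ a, φ (of b) = φ.restr x (of b) := fun b hb => by
      rw [restr_apply, inf_eq_left.2 ((of_le_of.2 hb).trans hax)]
    refine ⟨a, ha, hax.trans hxy, hax.trans (hxy.trans hy), fun b hb => ?_, fun c hc => ?_⟩
    · rw [hfix b hb]; exact hg.2.1 b hb
    · obtain ⟨b, hb⟩ := hg.2.2 c (hfix a le_rfl ▸ hc)
      refine ⟨b, ?_⟩
      rw [← hb, restr_symm_apply, eq_comm, inf_eq_left]
      refine (φ.symm.mono hc).trans ?_
      rw [φ.symm_apply_apply]
      exact inf_le_left.trans hax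

/-! ### Extending isomorphisms of lower sets to the completion -/

/-- The relation `R` is the graph of an isomorphism between two lower sets of `A`. -/
structure IsLowerIso (R : A → A → Prop) : Prop where
  bot : ∀ {x y}, R x y → (x = ⊥ ↔ y = ⊥)
  inf : ∀ {x y x' y'}, R x y → R x' y' → R (x ⊓ x') (y ⊓ y')
  left : ∀ {x y x'}, R x y → x' ≤ x → ∃ y' ≤ y, R x' y'
  right : ∀ {x y y'}, R x y → y' ≤ y → ∃ x' ≤ x, R x' y'

theorem IsLowerIso.flip {R : A → A → Prop} (h : IsLowerIso R) : IsLowerIso (flip R) where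
  bot h' := (h.bot h').symm
  inf := h.inf
  left := h.right
  right := h.left

/-- The extension of the relation `R` to the completion. -/
noncomputable def extend (R : A → A → Prop) (L : Completion A) : Completion A :=
  sSup {z | ∃ x y, R x y ∧ of x ≤ L ∧ z = of y}

theorem extend_mono (R : A → A → Prop) : Monotone (extend R) := fun _ _ h =>
  sSup_le_sSup fun _ ⟨x, y, h1, h2, h3⟩ => ⟨x, y, h1, h2.trans h, h3⟩

theorem le_extend {R : A → A → Prop} {x y : A} {L : Completion A} (h : R x y) (hx : of x ≤ L) :
    of y ≤ extend R L := le_sSup ⟨x, y, h, hx, rfl⟩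

theorem inf_extend_eq_bot {R : A → A → Prop} {v : A} {L : Completion A} :
    of v ⊓ extend R L = ⊥ ↔ ∀ x y, R x y → of x ≤ L → v ⊓ y = ⊥ := by
  constructor
  · intro h x y hR hx
    rw [← of_eq_bot, of_inf, ← le_bot_iff, ← h]
    exact inf_le_inf_left _ (le_extend hR hx)
  · intro h
    rw [extend, inf_sSup_eq, ← le_bot_iff]
    refine iSup₂_le ?_
    rintro _ ⟨x, y, h1, h2, rfl⟩
    rw [← of_inf, h x y h1 h2, of_bot]

namespace IsLowerIso
variable {R : A → A → Prop}

/-- If x is not below L, some nonzero part w of x is disjoint from L. The image of w lies below the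
extension, so it meets the image of some x' below L; but then w meets x'. -/
theorem le_extend_iff (h : IsLowerIso R) {x y : A} {L : Completion A} (hR : R x y) :
    of y ≤ extend R L ↔ of x ≤ L := by
  refine ⟨fun hy => ?_, le_extend hR⟩
  by_contra hx
  obtain ⟨w, hwx, hw, hwL⟩ := exists_disjoint_of_not_le hx
  obtain ⟨w', hw'y, hRw⟩ := h.left hR hwx
  apply hw
  rw [h.bot hRw, ← of_eq_bot, ← inf_eq_left.2 ((of_le_of.2 hw'y).trans hy), inf_extend_eq_bot]
  intro x' y' hR' hx'
  rw [← h.bot (h.inf hRw hR'), ← of_eq_bot, of_inf, ← le_bot_iff, ← hwL]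
  exact inf_le_inf_left _ hx'

/-- The preimage of `y' \ y` lies below x, and its meet with x corresponds to ⊥. For R and its flip
with x = x' this shows that R is single-valued and injective, which `IsLowerIso` does not demand. -/
theorem le_of_le (h : IsLowerIso R) {x y x' y' : A} (hR : R x y) (hR' : R x' y') (hx : x' ≤ x) :
    y' ≤ y := by
  obtain ⟨w, hw, hRw⟩ := h.right hR' (sdiff_le : y' \ y ≤ y')
  have h1 := (h.bot (h.inf hRw hR)).2 inf_sdiff_self_left
  rw [inf_eq_left.2 (hw.trans hx), h.bot hRw, sdiff_eq_bot_iff] at h1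
  exact h1

theorem extend_of (h : IsLowerIso R) {x y : A} (hR : R x y) : extend R (of x) = of y := by
  refine le_antisymm (sSup_le ?_) (le_extend hR le_rfl)
  rintro _ ⟨x', y', hR', hx', rfl⟩
  exact of_le_of.2 (h.le_of_le hR hR' (of_le_of.1 hx'))

theorem extend_flip_extend (h : IsLowerIso R) (L : Completion A) :
    extend (Function.swap R) (extend R L) = L ⊓ extend (Function.swap R) ⊤ := by
  refine le_antisymm (sSup_le ?_) (le_of_dense ?_)
  · rintro _ ⟨y, x, hR, hy, rfl⟩
    exact le_inf ((h.le_extend_iff hR).1 hy) (le_extend (R := Function.swap R) hR le_top)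
  · intro a ha haL
    have h1 : ¬ of a ⊓ extend (Function.swap R) ⊤ = ⊥ := by
      rw [inf_eq_left.2 (haL.trans inf_le_right), of_eq_bot]; exact ha
    rw [inf_extend_eq_bot] at h1
    push Not at h1
    obtain ⟨y, x, hR, -, h0⟩ := h1
    obtain ⟨b', -, hb'⟩ := h.left hR (inf_le_right : a ⊓ x ≤ x)
    refine ⟨a ⊓ x, inf_le_left, h0, le_extend (R := Function.swap R) hb' ?_⟩
    exact le_extend hb' ((of_le_of.2 inf_le_left).trans (haL.trans inf_le_left))

/-- The partial isomorphism of the completion that extends `R`. -/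
noncomputable def toPIso (h : IsLowerIso R) : PIso (Completion A) where
  toFun := extend R
  invFun := extend (Function.swap R)
  mono := extend_mono R
  mono_inv := extend_mono _
  left_inv := h.extend_flip_extend
  right_inv := h.flip.extend_flip_extend

theorem toPIso_apply_of (h : IsLowerIso R) {x y : A} (hR : R x y) : h.toPIso (of x) = of y :=
  h.extend_of hR

theorem toPIso_symm_apply_of (h : IsLowerIso R) {x y : A} (hR : R x y) :
    h.toPIso.symm (of y) = of x := h.flip.extend_of hR

theorem of_le_dom (h : IsLowerIso R) {x y : A} (hR : R x y) : of x ≤ h.toPIso.dom :=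
  le_extend (R := Function.swap R) hR le_top

theorem of_le_ran (h : IsLowerIso R) {x y : A} (hR : R x y) : of y ≤ h.toPIso.ran :=
  le_extend hR le_top

theorem inf_dom_eq_bot (h : IsLowerIso R) {v : A} :
    of v ⊓ h.toPIso.dom = ⊥ ↔ ∀ x y, R x y → v ⊓ x = ⊥ :=
  inf_extend_eq_bot.trans ⟨fun h x y hR => h y x hR le_top, fun h y x hR _ => h x y hR⟩

theorem toPIso_mem (h : IsLowerIso R) : h.toPIso ∈ (localPseudogroup A).carrier := by
  intro y hy hy0
  obtain ⟨v, hv, hvy⟩ := exists_of_le hy0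
  have h1 : ¬ of v ⊓ h.toPIso.dom = ⊥ := by
    rw [inf_eq_left.2 (hvy.trans hy), of_eq_bot]; exact hv
  rw [inf_dom_eq_bot] at h1
  push Not at h1
  obtain ⟨x, x', hR, h0⟩ := h1
  obtain ⟨b, -, hb⟩ := h.left hR (inf_le_right : v ⊓ x ≤ x)
  refine ⟨v ⊓ x, h0, (of_le_of.2 inf_le_left).trans hvy, h.of_le_dom hb, fun c hc => ?_,
    fun c hc => ?_⟩
  · obtain ⟨c', -, hc'⟩ := h.left hb hc
    exact ⟨c', h.toPIso_apply_of hc'⟩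
  · rw [h.toPIso_apply_of hb, of_le_of] at hc
    obtain ⟨c', -, hc'⟩ := h.right hb hc
    exact ⟨c', h.toPIso_symm_apply_of hc'⟩

end IsLowerIso

/-! ### From classes modulo ∼ to partial isomorphisms of the completion -/

section classCount

theorem classCount_mono {S T : Set (A →. A)} (h : S ⊆ T) : classCount S ≤ classCount T :=
  mk_le_mk_of_subset (Set.image_mono h)

theorem classCount_le {S : Set (A →. A)} {T : Type u} (F : S → T)
    (hF : ∀ f g : S, F f = F g → Sim f.1 g.1) : classCount S ≤ #T := by
  choose r hr hrq using fun q : (Quotient.mk (simSetoid A)) '' S => q.2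
  refine mk_le_of_injective (f := fun q => F ⟨r q, hr q⟩) fun q q' h => ?_
  refine Subtype.ext ?_
  rw [← hrq q, ← hrq q']
  exact Quotient.sound (s := simSetoid A) (hF _ _ h)

theorem le_classCount {S : Set (A →. A)} {T : Type u} (F : T → S)
    (hF : ∀ s t : T, Sim (F s).1 (F t).1 → s = t) : #T ≤ classCount S := by
  refine mk_le_of_injective (f := fun t =>
    (⟨Quotient.mk (simSetoid A) (F t).1, (F t).1, (F t).2, rfl⟩ :
      ((Quotient.mk (simSetoid A)) '' S : Set _))) fun s t h => hF s t ?_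
  exact Quotient.exact (s := simSetoid A) (congrArg Subtype.val h)

end classCount

theorem EndSet_mono : EndSet A Kind.k3 ⊆ EndSet A Kind.k4 ∧ EndSet A Kind.k3 ⊆ EndSet A Kind.k5 ∧
    ∀ e, EndSet A e ⊆ EndSet A Kind.k6 := by
  refine ⟨fun f ⟨I, _, h⟩ => ⟨I, h⟩, fun f ⟨I, hI, h⟩ => ⟨I, I, hI, hI, h⟩, fun e f hf => ?_⟩
  cases e with
  | k3 => obtain ⟨I, _, h⟩ := hf; exact ⟨I, I, h⟩
  | k4 => obtain ⟨I, h⟩ := hf; exact ⟨I, I, h⟩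
  | k5 => obtain ⟨I, J, _, _, h⟩ := hf; exact ⟨I, J, h⟩
  | k6 => exact hf

theorem autSim_mono {e e' : Kind} (h : EndSet A e ⊆ EndSet A e') : autSim A e ≤ autSim A e' :=
  classCount_mono fun _ hf => ⟨h hf.1, hf.2⟩

namespace IsHomOnto
variable {f : A →. A} {I J : Order.Ideal A}

theorem mem_dom_iff (h : IsHomOnto f I J) {x : A} : x ∈ I ↔ ∃ y, y ∈ f x := by
  rw [← SetLike.mem_coe, ← h.dom_eq]; exact PFun.mem_dom f x

theorem mem_ran_iff (h : IsHomOnto f I J) {y : A} : y ∈ J ↔ ∃ x, y ∈ f x := by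
  rw [← SetLike.mem_coe, ← h.ran_eq]; rfl

theorem isLowerIso (h : IsHomOnto f I J) (hk : TrivialKernel f) :
    IsLowerIso fun x y => y ∈ f x where
  bot := by
    intro x y hxy
    constructor
    · rintro rfl; exact Part.mem_unique hxy h.map_bot
    · rintro rfl; exact (hk x ((PFun.mem_dom f x).2 ⟨_, hxy⟩)).1 hxy
  inf h1 h2 := h.map_inf _ _ _ _ h1 h2
  left := by
    intro x y x' hxy hx
    obtain ⟨y', hy'⟩ := h.mem_dom_iff.1 (I.lower hx (h.mem_dom_iff.2 ⟨y, hxy⟩))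
    have h1 := h.map_inf _ _ _ _ hy' hxy
    rw [inf_eq_left.2 hx] at h1
    exact ⟨y', inf_eq_left.1 (Part.mem_unique h1 hy'), hy'⟩
  right := by
    intro x y y' hxy hy
    obtain ⟨x', hx'⟩ := h.mem_ran_iff.1 (J.lower hy (h.mem_ran_iff.2 ⟨x, hxy⟩))
    have h1 := h.map_inf _ _ _ _ hx' hxy
    rw [inf_eq_left.2 hy] at h1
    exact ⟨x' ⊓ x, inf_le_right, h1⟩

end IsHomOnto

theorem isLowerIso_of_mem {e : Kind} {f : A →. A} (hf : f ∈ AutSet A e) :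
    IsLowerIso fun x y => y ∈ f x := by
  obtain ⟨I, J, h⟩ := EndSet_mono.2.2 e hf.1
  exact h.isLowerIso hf.2

/-- The range is an ideal and f preserves meets: a preimage of y can be cut down to x. -/
theorem AutvSet_eq_AutSet (e : Kind) : AutvSet A e = AutSet A e := by
  ext f
  refine ⟨fun h => ⟨h.1.1, h.2⟩, fun h => ⟨⟨h.1, ?_⟩, h.2⟩⟩
  intro x z y hz _ hyz
  exact (isLowerIso_of_mem h).right hz hyz

theorem autvSim_eq_autSim (e : Kind) : autvSim A e = autSim A e := by
  rw [autvSim, autSim, AutvSet_eq_AutSet]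

theorem ker_eq {e : Kind} {f : A →. A} (hf : f ∈ AutSet A e) : ker f = {⊥} := by
  obtain ⟨I, J, h⟩ := EndSet_mono.2.2 e hf.1
  ext x
  rw [Set.mem_singleton_iff]
  exact ⟨fun hx => ((isLowerIso_of_mem hf).bot hx).2 rfl, fun hx => hx ▸ h.map_bot⟩

theorem sim_of_toPIso_eq {e : Kind} {f g : A →. A} (hf : f ∈ AutSet A e) (hg : g ∈ AutSet A e)
    (h : (isLowerIso_of_mem hf).toPIso = (isLowerIso_of_mem hg).toPIso) : Sim f g := by
  obtain ⟨I, J, hfI⟩ := EndSet_mono.2.2 e hf.1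
  obtain ⟨I', J', hgI⟩ := EndSet_mono.2.2 e hg.1
  have hperp : ∀ v, v ∈ perp (I : Set A) ↔ v ∈ perp (I' : Set A) := fun v => by
    have h1 : ∀ (f : A →. A) (hf : f ∈ AutSet A e) (I J : Order.Ideal A), IsHomOnto f I J →
        (v ∈ perp (I : Set A) ↔ of v ⊓ (isLowerIso_of_mem hf).toPIso.dom = ⊥) :=
      fun f hf I J hI => by
        rw [IsLowerIso.inf_dom_eq_bot]
        exact ⟨fun hv x y hxy => hv x (hI.mem_dom_iff.2 ⟨y, hxy⟩),
          fun hv x hx => (hI.mem_dom_iff.1 hx).elim fun y hy => hv x y hy⟩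
    rw [h1 f hf I J hfI, h1 g hg I' J' hgI, h]
  -- Equal extensions have equal domains, so I and I' have the same orthogonal complement. On the
  -- common part of I and I' both maps agree; at `a ⊔ v` with v nonzero in that complement both are
  -- undefined. D collects the two kinds and meets every nonzero element.
  let D : Order.Ideal A :=
    { carrier := {x | ∃ a ∈ I, a ∈ I' ∧ ∃ v ∈ perp (I : Set A), x = a ⊔ v}
      lower' := by
        rintro _ w hw ⟨a, ha, ha', v, hv, rfl⟩
        refine ⟨w ⊓ a, I.lower inf_le_right ha, I'.lower inf_le_right ha', w ⊓ v,
          perp_lower hv inf_le_right, ?_⟩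
        rw [← inf_sup_left, inf_eq_left.2 hw]
      nonempty' := ⟨⊥, ⊥, I.bot_mem, I'.bot_mem, ⊥, bot_mem_perp _, by simp⟩
      directed' := by
        rintro x ⟨a, ha, ha', v, hv, rfl⟩ y ⟨b, hb, hb', w, hw, rfl⟩
        exact ⟨(a ⊔ v) ⊔ (b ⊔ w), ⟨a ⊔ b, Order.Ideal.sup_mem ha hb, Order.Ideal.sup_mem ha' hb',
          v ⊔ w, perp_sup hv hw, sup_sup_sup_comm _ _ _ _⟩, le_sup_left, le_sup_right⟩ }
  have key : ∀ x ∈ D, ∀ y, y ∈ f x ↔ y ∈ g x := by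
    rintro _ ⟨a, ha, ha', v, hv, rfl⟩ y
    have hv0 : ∀ K : Order.Ideal A, v ∈ perp (K : Set A) → a ⊔ v ∈ K → v = ⊥ := fun K hvK hK => by
      have h1 := hvK v (K.lower le_sup_right hK)
      rwa [inf_idem] at h1
    have hfg : ∀ y, y ∈ f a ↔ y ∈ g a := fun y => by
      obtain ⟨z, hz⟩ := hfI.mem_dom_iff.1 ha
      obtain ⟨z', hz'⟩ := hgI.mem_dom_iff.1 ha'
      have h1 : z = z' := of_injective (by
        rw [← (isLowerIso_of_mem hf).toPIso_apply_of hz, h,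
          (isLowerIso_of_mem hg).toPIso_apply_of hz'])
      subst h1
      exact ⟨fun hy => Part.mem_unique hy hz ▸ hz', fun hy => Part.mem_unique hy hz' ▸ hz⟩
    constructor
    · intro hy
      have h0 := hv0 I hv (hfI.mem_dom_iff.2 ⟨y, hy⟩)
      rw [h0, sup_bot_eq] at hy ⊢
      exact (hfg y).1 hy
    · intro hy
      have h0 := hv0 I' ((hperp v).1 hv) (hgI.mem_dom_iff.2 ⟨y, hy⟩)
      rw [h0, sup_bot_eq] at hy ⊢
      exact (hfg y).2 hy
  refine ⟨(ker_eq hf).trans (ker_eq hg).symm, D, ?_, ?_, fun x hx => Part.ext (key x hx)⟩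
  · rw [ker_eq hf, Set.singleton_subset_iff]
    exact D.bot_mem
  · intro a ha
    rw [ker_eq hf] at ha ⊢
    by_cases hv : a ∈ perp (I : Set A)
    · exact ⟨a, ⟨⊥, I.bot_mem, I'.bot_mem, a, hv, by simp⟩, ha, le_rfl⟩
    · have h1 : ∃ u ∈ I, a ⊓ u ≠ ⊥ := by
        by_contra! hc; exact hv hc
      obtain ⟨u, hu, hau⟩ := h1
      have h2 : a ⊓ u ∉ perp (I' : Set A) := fun h3 => by
        have h4 := (hperp _).2 h3 u hu
        rw [inf_assoc, inf_idem] at h4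
        exact hau h4
      have h3 : ∃ u' ∈ I', a ⊓ u ⊓ u' ≠ ⊥ := by
        by_contra! hc; exact h2 hc
      obtain ⟨u', hu', h0⟩ := h3
      exact ⟨a ⊓ u ⊓ u', ⟨a ⊓ u ⊓ u', I.lower (inf_le_left.trans inf_le_right) hu,
        I'.lower inf_le_right hu', ⊥, bot_mem_perp _, by simp⟩, h0, inf_le_left.trans inf_le_left⟩

theorem autSim_le_mk_carrier (e : Kind) : autSim A e ≤ #(localPseudogroup A).carrier :=
  classCount_le (fun f : AutSet A e => ⟨_, (isLowerIso_of_mem f.2).toPIso_mem⟩) fun f g h =>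
    sim_of_toPIso_eq f.2 g.2 (congrArg Subtype.val h)

theorem autSim_k5_le_mk_grp : autSim A Kind.k5 ≤ #((localPseudogroup A).grp ⊤) := by
  have key : ∀ f : AutSet A Kind.k5,
      (isLowerIso_of_mem f.2).toPIso ∈ (localPseudogroup A).grp ⊤ := by
    rintro ⟨f, ⟨I, J, hI, hJ, h⟩, hk⟩
    refine ⟨IsLowerIso.toPIso_mem _, top_le_iff.1 (le_of_dense fun a ha _ => ?_),
      top_le_iff.1 (le_of_dense fun a ha _ => ?_)⟩
    · obtain ⟨b, hb, hb0, hba⟩ := hI a ha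
      obtain ⟨c, hc⟩ := h.mem_dom_iff.1 hb
      exact ⟨b, hba, hb0, IsLowerIso.of_le_dom _ hc⟩
    · obtain ⟨b, hb, hb0, hba⟩ := hJ a ha
      obtain ⟨c, hc⟩ := h.mem_ran_iff.1 hb
      exact ⟨b, hba, hb0, IsLowerIso.of_le_ran _ hc⟩
  exact classCount_le (fun f : AutSet A Kind.k5 => ⟨_, key f⟩) fun f g h =>
    sim_of_toPIso_eq f.2 g.2 (congrArg Subtype.val h)

/-! ### Pairwise inequivalent maps: identities of ideals and involutions -/

/-- The identity of an ideal. -/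
def idIdeal (I : Order.Ideal A) : A →. A := fun x => ⟨x ∈ I, fun _ => x⟩

theorem mem_idIdeal {I : Order.Ideal A} {x y : A} : y ∈ idIdeal I x ↔ x ∈ I ∧ x = y :=
  ⟨fun ⟨h, h'⟩ => ⟨h, h'⟩, fun ⟨h, h'⟩ => ⟨h, h'⟩⟩

theorem idIdeal_mem (I : Order.Ideal A) : idIdeal I ∈ AutSet A Kind.k4 := by
  refine ⟨⟨I, rfl, ?_, ?_, ?_, ?_⟩, fun x hx => ?_⟩
  · ext y
    exact ⟨fun ⟨x, hx⟩ => by obtain ⟨h, rfl⟩ := mem_idIdeal.1 hx; exact h,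
      fun h => ⟨y, mem_idIdeal.2 ⟨h, rfl⟩⟩⟩
  · exact mem_idIdeal.2 ⟨I.bot_mem, rfl⟩
  · intro x y x' y' hx hy
    obtain ⟨hxI, rfl⟩ := mem_idIdeal.1 hx
    obtain ⟨hyI, rfl⟩ := mem_idIdeal.1 hy
    exact mem_idIdeal.2 ⟨Order.Ideal.sup_mem hxI hyI, rfl⟩
  · intro x y x' y' hx hy
    obtain ⟨hxI, rfl⟩ := mem_idIdeal.1 hx
    obtain ⟨hyI, rfl⟩ := mem_idIdeal.1 hy
    exact mem_idIdeal.2 ⟨I.lower inf_le_left hxI, rfl⟩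
  · exact mem_idIdeal.trans ⟨fun h => h.2, fun h => ⟨hx, h⟩⟩

/-- Where the two identities agree, membership in I and in J is the same. This happens on a dense
ideal, so J is dense below each element of I, and J is closed. -/
theorem le_of_sim_idIdeal {I J : Order.Ideal A} (hJ : J ∈ Idc A)
    (h : Sim (idIdeal I) (idIdeal J)) : I ≤ J := by
  obtain ⟨-, D, -, hD, heq⟩ := h
  rw [ker_eq (idIdeal_mem I)] at hD
  intro x hx
  have hJ' : closureSet J = (J : Set A) := hJ
  change x ∈ (J : Set A)
  rw [← hJ']
  intro y hyx hy
  obtain ⟨b, hb, hb0, hby⟩ := hD y hy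
  have h1 : b ∈ idIdeal I b := mem_idIdeal.2 ⟨I.lower (hby.trans hyx) hx, rfl⟩
  rw [heq b hb] at h1
  exact ⟨b, (mem_idIdeal.1 h1).1, hb0, hby⟩

theorem idc_le_autSim_k4 : idc A ≤ autSim A Kind.k4 :=
  le_classCount (fun I : Idc A => ⟨idIdeal I.1, idIdeal_mem I.1⟩) fun I J h =>
    Subtype.ext (le_antisymm (le_of_sim_idIdeal J.2 h) (le_of_sim_idIdeal I.2 h.symm))

theorem ext_of_dense {φ ψ : PIso (Completion A)} (E : Set A)
    (hE : ∀ a : A, a ≠ ⊥ → ∃ b ≤ a, b ≠ ⊥ ∧ b ∈ E) (h : ∀ b ∈ E, φ (of b) = ψ (of b)) : φ = ψ := by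
  refine PIso.ext fun x => ?_
  have hx : x = ⨆ b : {b // b ∈ E ∧ of b ≤ x}, of b.1 := by
    refine le_antisymm (le_of_dense fun a ha hax => ?_) (iSup_le fun b => b.2.2)
    obtain ⟨b, hba, hb, hbE⟩ := hE a ha
    exact ⟨b, hba, hb, le_iSup (fun b : {b // b ∈ E ∧ of b ≤ x} => of b.1)
      ⟨b, hbE, (of_le_of.2 hba).trans hax⟩⟩
  rw [hx, PIso.map_iSup, PIso.map_iSup]
  exact iSup_congr fun b => h _ b.2.1

/-- The partial function on `A` induced by a partial isomorphism of the completion. -/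
noncomputable def goodPart (φ : PIso (Completion A)) : A →. A :=
  fun a => ⟨Good φ a, fun h => (h.2.1 a le_rfl).choose⟩

theorem mem_goodPart {φ : PIso (Completion A)} {a c : A} :
    c ∈ goodPart φ a ↔ Good φ a ∧ φ (of a) = of c := by
  constructor
  · rintro ⟨h, rfl⟩; exact ⟨h, (h.2.1 a le_rfl).choose_spec⟩
  · rintro ⟨h, hc⟩
    exact ⟨h, of_injective ((h.2.1 a le_rfl).choose_spec.symm.trans hc)⟩

theorem exists_good {φ : PIso (Completion A)} (h : φ ∈ (localPseudogroup A).grp ⊤) {a : A}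
    (ha : a ≠ ⊥) : ∃ b, b ≠ ⊥ ∧ b ≤ a ∧ Good φ b := by
  obtain ⟨b, hb, hba, hg⟩ := h.1 (of a) (h.2.1 ▸ le_top) fun h0 => ha (of_eq_bot.1 h0)
  exact ⟨b, hb, of_le_of.1 hba, hg⟩

/-- An element is good for s exactly when its image is good for the inverse of s. As s is its own
inverse, the ideal of good elements is mapped onto itself, as membership in Aut_3 requires; a
general automorphism would only map one dense ideal onto another. -/
theorem goodPart_mem {s : PIso (Completion A)} (hs : s ∈ (localPseudogroup A).inv) :
    goodPart s ∈ AutSet A Kind.k3 ∧ ∀ x y, y ∈ goodPart s x → x ∈ goodPart s y := by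
  have hsymm : ∀ x y, y ∈ goodPart s x → x ∈ goodPart s y := by
    intro x y hxy
    rw [mem_goodPart] at hxy ⊢
    refine ⟨hs.2 ▸ hxy.1.symm hxy.2, ?_⟩
    have h1 := s.symm_apply_apply_of_le hxy.1.1
    rwa [hs.2, hxy.2] at h1
  let I : Order.Ideal A :=
    { carrier := {a | Good s a}
      lower' := fun _ _ h ha => Good.lower ha h
      nonempty' := ⟨⊥, Good.bot⟩
      directed' := fun a ha b hb => ⟨a ⊔ b, Good.sup ha hb, le_sup_left, le_sup_right⟩ }
  refine ⟨⟨⟨I, fun a ha => ?_, rfl, ?_, ?_, ?_, ?_⟩, fun x hx => ?_⟩, hsymm⟩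
  · obtain ⟨b, hb, hba, hg⟩ := exists_good hs.1 ha
    exact ⟨b, hg, hb, hba⟩
  · ext y
    constructor
    · rintro ⟨x, hx⟩
      exact (mem_goodPart.1 (hsymm _ _ hx)).1
    · intro hy
      obtain ⟨c, hc⟩ := hy.2.1 y le_rfl
      exact ⟨c, hsymm _ _ (mem_goodPart.2 ⟨hy, hc⟩)⟩
  · exact mem_goodPart.2 ⟨Good.bot, by simp⟩
  · intro x y x' y' hx hy
    rw [mem_goodPart] at hx hy ⊢
    exact ⟨hx.1.sup hy.1, by rw [of_sup, PIso.map_sup, hx.2, hy.2, of_sup]⟩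
  · intro x y x' y' hx hy
    rw [mem_goodPart] at hx hy ⊢
    exact ⟨hx.1.lower inf_le_left, by rw [of_inf, PIso.map_inf, hx.2, hy.2, of_inf]⟩
  · rw [mem_goodPart, of_bot, apply_eq_bot, hs.1.2.1, inf_top_eq, of_eq_bot]
    exact ⟨fun h => h.2, fun h => ⟨hx, h⟩⟩

theorem isOrderTwo_goodPart {s : PIso (Completion A)} (hs : s ∈ (localPseudogroup A).inv)
    (hne : s ≠ idOn ⊤) : IsOrderTwo (goodPart s) := by
  refine ⟨(goodPart_mem hs).2, ?_⟩
  by_contra! hc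
  refine hne (ext_of_dense {a | Good s a} (fun a ha => ?_) fun b hb => ?_)
  · obtain ⟨b, hb, hba, hg⟩ := exists_good hs.1 ha
    exact ⟨b, hba, hb, hg⟩
  · obtain ⟨c, hc'⟩ := hb.2.1 b le_rfl
    rw [idOn_apply, inf_top_eq, hc', hc b c (mem_goodPart.2 ⟨hb, hc'⟩)]

theorem eq_of_sim_goodPart {s t : PIso (Completion A)} (hs : s ∈ (localPseudogroup A).inv)
    (h : Sim (goodPart s) (goodPart t)) : s = t := by
  obtain ⟨-, D, -, hD, heq⟩ := h
  rw [ker_eq (goodPart_mem hs).1] at hD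
  refine ext_of_dense {a | a ∈ D ∧ Good s a} (fun a ha => ?_) fun b hb => ?_
  · obtain ⟨b, hbD, hb, hba⟩ := hD a ha
    obtain ⟨c, hc, hcb, hg⟩ := exists_good hs.1 hb
    exact ⟨c, hcb.trans hba, hc, D.lower hcb hbD, hg⟩
  · obtain ⟨c, hc⟩ := hb.2.2.1 b le_rfl
    have h1 : c ∈ goodPart s b := mem_goodPart.2 ⟨hb.2, hc⟩
    rw [heq b hb.1, mem_goodPart] at h1
    rw [hc, h1.2]

/-! ### Comparison of the counts -/

theorem mk_inv_le : #(localPseudogroup A).inv ≤ autSimOrderTwo A Kind.k3 + 1 := by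
  -- The identity is its own inverse without having order two; it accounts for the summand 1.
  have h1 : (localPseudogroup A).inv ⊆
      insert (idOn ⊤) {s | s ∈ (localPseudogroup A).inv ∧ s ≠ idOn ⊤} := fun s hs => by
    by_cases h : s = idOn ⊤
    · exact Or.inl h
    · exact Or.inr ⟨hs, h⟩
  refine (mk_le_mk_of_subset h1).trans (mk_insert_le.trans (add_le_add_left ?_ 1))
  exact le_classCount (fun s : {s | s ∈ (localPseudogroup A).inv ∧ s ≠ idOn ⊤} =>
    ⟨goodPart s.1, (goodPart_mem s.2.1).1, isOrderTwo_goodPart s.2.1 s.2.2⟩)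
    fun s t h => Subtype.ext (eq_of_sim_goodPart s.2.1 h)

theorem autSimOrderTwo_le (e : Kind) : autSimOrderTwo A e ≤ autSim A e :=
  classCount_mono fun _ h => h.1

theorem autSimOrderTwo_k3_le_k5 : autSimOrderTwo A Kind.k3 ≤ autSimOrderTwo A Kind.k5 :=
  classCount_mono fun _ h => ⟨⟨EndSet_mono.2.1 h.1.1, h.1.2⟩, h.2⟩

theorem mk_grp_le_of_inv_le {c : Cardinal.{u}} (hc : ℵ₀ ≤ c) (h : #(localPseudogroup A).inv ≤ c) :
    #((localPseudogroup A).grp ⊤) ≤ c := by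
  refine (localPseudogroup A).mk_grp_le.trans ?_
  have h1 : #(localPseudogroup A).disj ≤ c :=
    (localPseudogroup A).mk_disj_le_inv.trans ((mul_le_mul' h h).trans (mul_eq_self hc).le)
  calc #(localPseudogroup A).disj ^ 3 ≤ c ^ 3 := pow_le_pow_left' h1 3
    _ ≤ c := power_nat_le hc

/-- If the order-two count is finite, there are finitely many involutions, hence finitely many
automorphisms. If it is infinite, the summand 1 is absorbed, and the cycle from the order-two count
through aut_5 and the number of automorphisms closes. -/
theorem autSim_trichotomy :
    (autSimOrderTwo A Kind.k3 = autSim A Kind.k5 ∧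
      autSim A Kind.k5 = #((localPseudogroup A).grp ⊤)) ∨ autSim A Kind.k5 < ℵ₀ := by
  rcases lt_or_ge (autSimOrderTwo A Kind.k3) ℵ₀ with hfin | hinf
  · right
    have h1 : #(localPseudogroup A).inv < ℵ₀ :=
      mk_inv_le.trans_lt (add_lt_aleph0 hfin one_lt_aleph0)
    refine autSim_k5_le_mk_grp.trans_lt ((localPseudogroup A).mk_grp_le.trans_lt ?_)
    have h2 := (localPseudogroup A).mk_disj_le_inv.trans_lt (mul_lt_aleph0 h1 h1)
    obtain ⟨n, hn⟩ := lt_aleph0.1 h2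
    rw [hn]
    exact_mod_cast natCast_lt_aleph0 (n := n ^ 3)
  · left
    have h1 : #((localPseudogroup A).grp ⊤) ≤ autSimOrderTwo A Kind.k3 :=
      mk_grp_le_of_inv_le hinf (mk_inv_le.trans_eq (add_one_eq hinf))
    have h2 : autSimOrderTwo A Kind.k3 ≤ autSim A Kind.k5 :=
      autSimOrderTwo_k3_le_k5.trans (autSimOrderTwo_le _)
    exact ⟨le_antisymm h2 (autSim_k5_le_mk_grp.trans h1),
      le_antisymm autSim_k5_le_mk_grp (h1.trans h2)⟩

/-- As idc(A) appears on the right, recording domains is free and the cruder `mk_disj_le` suffices.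
-/
theorem autSim_le_add [Infinite A] (e : Kind) : autSim A e ≤ autSim A Kind.k3 + idc A := by
  have hi : ℵ₀ ≤ idc A := aleph0_le_idc
  set c := autSim A Kind.k3 + idc A with hc
  have hic : idc A ≤ c := self_le_add_left _ _
  have hc0 : ℵ₀ ≤ c := hi.trans hic
  have h1 : #(localPseudogroup A).inv ≤ c := mk_inv_le.trans
    (add_le_add (autSimOrderTwo_le _) (one_le_aleph0.trans hi))
  have hB : #(Completion A) ≤ c := mk_completion_eq_idc.trans_le hic
  have h2 : #(localPseudogroup A).disj ≤ c :=
    (localPseudogroup A).mk_disj_le.trans ((mul_le_mul' h1 hB).trans (mul_eq_self hc0).le)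
  refine (autSim_le_mk_carrier e).trans ((localPseudogroup A).mk_carrier_le.trans ?_)
  calc #(localPseudogroup A).disj ^ 3 * #(Completion A) ≤ c ^ 3 * c :=
        mul_le_mul' (pow_le_pow_left' h2 3) hB
    _ ≤ c * c := mul_le_mul' (power_nat_le hc0) le_rfl
    _ = c := mul_eq_self hc0

theorem autSim_k4_eq [Infinite A] : autSim A Kind.k4 = autSim A Kind.k3 + idc A := by
  refine le_antisymm (autSim_le_add _) ?_
  have h4 : idc A ≤ autSim A Kind.k4 := idc_le_autSim_k4
  exact add_le_of_le (aleph0_le_idc.trans h4) (autSim_mono EndSet_mono.1) h4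

theorem autSim_k6_eq [Infinite A] : autSim A Kind.k6 = autSim A Kind.k3 + idc A :=
  le_antisymm (autSim_le_add _) (autSim_k4_eq.symm.trans_le (autSim_mono (EndSet_mono.2.2 _)))

end BAIdeal

open BAIdeal

theorem mainTheorem5 (A : Type u) [BooleanAlgebra A] [Infinite A] :
    ((autSim A Kind.k3 = autSim A Kind.k5 ∧
        autSimOrderTwo A Kind.k3 = autSim A Kind.k3 ∧
        autSimOrderTwo A Kind.k5 = autSim A Kind.k5) ∨
      (autSim A Kind.k3 < ℵ₀ ∧ autSim A Kind.k5 < ℵ₀)) ∧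
    ((∃ e : Kind, idc A < autSim A e) → ∀ e e' : Kind, autSim A e = autSim A e') ∧
    (autSim A Kind.k3 = autSim A Kind.k3 ^ ℵ₀ ∨ autSim A Kind.k3 < ℵ₀) ∧
    (autvSim A Kind.k4 = autvSim A Kind.k3 + idc A ∧
      autvSim A Kind.k6 = autvSim A Kind.k3 + idc A) := by
  have h35 : autSim A Kind.k3 ≤ autSim A Kind.k5 := autSim_mono EndSet_mono.2.1
  have hi : ℵ₀ ≤ idc A := aleph0_le_idc
  have h1 : (autSimOrderTwo A Kind.k3 = autSim A Kind.k5 ∧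
      autSim A Kind.k5 = #((localPseudogroup A).grp ⊤)) ∨ autSim A Kind.k5 < ℵ₀ :=
    autSim_trichotomy
  have heq : autSimOrderTwo A Kind.k3 = autSim A Kind.k5 → autSim A Kind.k3 = autSim A Kind.k5 :=
    fun h => le_antisymm h35 (h ▸ autSimOrderTwo_le _)
  refine ⟨?_, ?_, ?_, ?_⟩
  · rcases h1 with ⟨h, -⟩ | h
    · exact Or.inl ⟨heq h, h.trans (heq h).symm,
        le_antisymm (autSimOrderTwo_le _) (h ▸ autSimOrderTwo_k3_le_k5)⟩
    · exact Or.inr ⟨h35.trans_lt h, h⟩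
  · rintro ⟨e, he⟩
    -- Every count is at most aut_3 + idc(A), which is idc(A) when aut_3 ≤ idc(A).
    have h3 : idc A < autSim A Kind.k3 := by
      by_contra hc
      have h4 := (autSim_le_add e).trans (add_le_of_le hi (not_lt.1 hc) le_rfl)
      exact absurd he (not_lt.2 h4)
    have h5 : autSim A Kind.k3 = autSim A Kind.k5 := by
      rcases h1 with ⟨h, -⟩ | h
      · exact heq h
      · exact absurd ((hi.trans h3.le).trans h35) (not_le.2 h)
    have hadd : autSim A Kind.k3 + idc A = autSim A Kind.k3 :=
      add_eq_left (hi.trans h3.le) h3.le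
    have hall : ∀ e, autSim A e = autSim A Kind.k3 := by
      intro e
      cases e with
      | k3 => rfl
      | k4 => rw [autSim_k4_eq, hadd]
      | k5 => exact h5.symm
      | k6 => rw [autSim_k6_eq, hadd]
    exact fun e e' => (hall e).trans (hall e').symm
  · rcases h1 with ⟨h, hg⟩ | h
    · rw [heq h, hg]
      exact (localPseudogroup A).mk_grp_top_lt_aleph0_or_power_eq.symm.imp Eq.symm id
    · exact Or.inr (h35.trans_lt h)
  · simp only [autvSim_eq_autSim]
    exact ⟨autSim_k4_eq, autSim_k6_eq⟩
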